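/- Let $d\in\{2,3\}$, let $\Omega\subset\mathbb R^d$ be open, bounded and convex, $X=\Omega\times S^{d-1}$, $\Gamma_-=\{(x,\theta)\in\partial\Omega\times S^{d-1}:\theta\cdot\nu(x)<0\}$ ($\nu$ the outward unit normal), $1\le p\le\infty$, and let $f\ge 0$ be a measurable symmetric scattering kernel on $S^{d-1}\times S^{d-1}$ with $\int_{S^{d-1}} f(\theta,\theta')\,d\theta'=1$. Put $(K\phi)(x,\theta)=\int f(\theta,\theta')\phi(x,\theta')\,d\theta'$, $(A\phi)(x)=\int_{S^{d-1}}\phi(x,\theta)\,d\theta$, $\tilde A=|S^{d-1}|^{-1}A$. Let $0<c_1\le c_2<\infty$, let $\mu_{a,xi},\mu_{s,x},\mu_{a,m},\mu_{s,m}$ and $\mu^*$ (the true fluorophore absorption coefficient $\mu_{a,xf}^*$) be measurable on $\Omega$ with values in $[c_1,c_2]$, let $\eta$ be measurable with $0\le\eta<1$, and let $q_b>0$ a.e. on $\Gamma_-$, with $q_b$ (extended to $X$ constantly along the lines of direction $\theta$) in $L^p(X)$; this holds in particular if $q_b\in L^p(\Gamma_-,|\theta\cdot\nu|)$. For a fluorophore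 absorption coefficient $\mu$, let $T_1(\mu)\in L^p(X)$ denote the solution $\phi_x$ of $$(\theta\cdot\nabla+\mu_{a,xi}+\mu+\mu_{s,x}-\mu_{s,x}K)\phi_x=0\ \text{in }X,\qquad \phi_x=q_b\ \text{on }\Gamma_-,$$ and for $\psi\in L^p(X)$ let $E(\mu,\psi)\in L^p(X)$ denote the solution $\phi_m$ of $$(\theta\cdot\nabla+\mu_{a,m}+\mu_{s,m}-\mu_{s,m}K)\phi_m=\eta\,\mu\,\tilde A\psi\ \text{in }X,\qquad \phi_m=0\ \text{on }\Gamma_-.$$ (A solution is an $L^p(X)$ function having a representative that is locally absolutely continuous along almost every line of direction $\theta$ in $\Omega$, satisfies the equation a.e. on it, and has the prescribed limit at the inflow point.) Put $\phi_x^*=T_1(\mu^*)$, $\phi_m^*=E(\mu^*,\phi_x^*)$ and $$h^*=(\mu_{a,xi}+(1-\eta)\mu^*)A\phi_x^*+\mu_{a,m}A\phi_m^*.$$ The squeeze iteration starts from $\underline\mu^0=c_1$, $\overline\mu^0=c_2$ and sets, for $i=0,1,2,\dots$, $$\underline\phi_x^i=T_1(\underline\mu^i),\quad \overline\phi_x^i=T_1(\overline\mu^i),\quad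 \overline\phi_m^i=E(\overline\mu^i,\underline\phi_x^i),\quad \underline\phi_m^i=E(\underline\mu^i,\overline\phi_x^i),$$ $$\underline\mu^{i+1}=\max\Big\{\underline\mu^i,\tfrac1{1-\eta}\Big(\tfrac{h^*-\mu_{a,m}A\overline\phi_m^i}{A\underline\phi_x^i}-\mu_{a,xi}\Big)\Big\},\qquad \overline\mu^{i+1}=\min\Big\{\overline\mu^i,\tfrac1{1-\eta}\Big(\tfrac{h^*-\mu_{a,m}A\underline\phi_m^i}{A\overline\phi_x^i}-\mu_{a,xi}\Big)\Big\}.$$ Suppose $c_1<\mu^*<c_2$ a.e. in $\Omega$. Then $\phi_x^*,\phi_m^*$ exist, the squeeze iteration can be carried out for all $i$, and for every $i\ge0$, almost everywhere, $$\underline\mu^i\le\underline\mu^{i+1}\le\mu^*<\overline\mu^{i+1}\le\overline\mu^i,$$ $$\underline\phi_x^i\ge\underline\phi_x^{i+1}\ge\phi_x^*\ge\overline\phi_x^{i+1}\ge\overline\phi_x^i,$$ $$\underline\phi_m^i\le\underline\phi_m^{i+1}\le\phi_m^*\le\overline\phi_m^{i+1}\le\overline\phi_m^i .$$ If moreover $\eta>0$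 a.e. in $\Omega$, then $\phi_m^*<\overline\phi_m^i$ a.e. in $X$ for every $i\ge 0$. -/

import Mathlib

open MeasureTheory Set Filter Topology
open scoped ENNReal

noncomputable section

namespace FPAT

/-- Euclidean space of dimension `d`. -/
abbrev Space (d : ℕ) : Type := EuclideanSpace ℝ (Fin d)

/-- Directions: the unit sphere of the Euclidean space of dimension `d`. -/
abbrev Dir (d : ℕ) : Type := Metric.sphere (0 : Space d) 1

variable {d : ℕ}

/-- Surface measure on the unit sphere. -/
def angularMeasure (d : ℕ) : Measure (Dir d) := (volume : Measure (Space d)).toSphere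

/-- The measure `dx dθ` on the phase space `X = Ω × S^{d-1}`. -/
def phaseMeasure (Ω : Set (Space d)) : Measure (Space d × Dir d) :=
  (volume.restrict Ω).prod (angularMeasure d)

/-- The scattering operator `(K φ)(x, θ) = ∫ f(θ, θ') φ(x, θ') dθ'`. -/
def scatter (f : Dir d → Dir d → ℝ) (φ : Space d × Dir d → ℝ) (z : Space d × Dir d) : ℝ :=
  ∫ θ', f z.2 θ' * φ (z.1, θ') ∂(angularMeasure d)

/-- The operator `(A φ)(x) = ∫ φ(x, θ) dθ`. -/
def angularInt (φ : Space d × Dir d → ℝ) (x : Space d) : ℝ :=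
  ∫ θ, φ (x, θ) ∂(angularMeasure d)

/-- The operator `(Ã φ)(x) = (1 / S_d) ∫ φ(x, θ) dθ`, with `S_d` the area of the unit sphere. -/
def angularMean (φ : Space d × Dir d → ℝ) (x : Space d) : ℝ :=
  ((angularMeasure d).real univ)⁻¹ * angularInt φ x

/-- A scattering kernel: measurable, nonnegative, symmetric, and a probability density in its
second variable. -/
structure IsScatteringKernel (f : Dir d → Dir d → ℝ) : Prop where
  measurable : Measurable (Function.uncurry f)
  nonneg : ∀ θ θ', 0 ≤ f θ θ'
  symm : ∀ θ θ', f θ θ' = f θ' θ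
  integral_eq_one : ∀ θ, ∫ θ', f θ θ' ∂(angularMeasure d) = 1

/-- The class `D(Ω)` of measurable coefficients with values between `c₁` and `c₂`. -/
structure IsCoeff (Ω : Set (Space d)) (c₁ c₂ : ℝ) (μ : Space d → ℝ) : Prop where
  aestronglyMeasurable : AEStronglyMeasurable μ (volume.restrict Ω)
  bounds : ∀ᵐ x ∂(volume.restrict Ω), c₁ ≤ μ x ∧ μ x ≤ c₂

/-- For `x ∈ Ω`, the distance `τ(x, θ)` from `x` to `∂Ω` in the direction `-θ`. -/
def backTime (Ω : Set (Space d)) (z : Space d × Dir d) : ℝ :=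
  sSup {t : ℝ | 0 ≤ t ∧ z.1 - t • (z.2 : Space d) ∈ Ω}

/-- For `x ∈ Ω`, the point `(x - τ(x, θ) θ, θ)` of the inflow boundary `Γ₋` at which the
characteristic line through `(x, θ)` enters `Ω`. -/
def inflowPoint (Ω : Set (Space d)) (z : Space d × Dir d) : Space d × Dir d :=
  (z.1 - backTime Ω z • (z.2 : Space d), z.2)

/-- A function on the inflow boundary, extended to the phase space constantly along the
characteristic lines.  Since
`∫_X |inflowExt Ω q_b|^p dx dθ = ∫_{Γ₋} τ₊ |q_b|^p |θ·ν| dS dθ`, where `τ₊` is the (positive,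
bounded) length of the chord that starts at the given inflow point, null sets of `Γ₋` correspond
to null sets of `X`, and the extension of every `q_b ∈ L^p(Γ₋, |θ·ν|)` is in `L^p(X)`. -/
def inflowExt (Ω : Set (Space d)) (qb : Space d × Dir d → ℝ) (z : Space d × Dir d) : ℝ :=
  qb (inflowPoint Ω z)

/-- The point `(x + t θ, θ)` on the characteristic line through `(x, θ)`. -/
def flow (z : Space d × Dir d) (t : ℝ) : Space d × Dir d :=
  (z.1 + t • (z.2 : Space d), z.2)

/-- `φ` is an `L^p` solution of the stationary radiative transfer equation
`(θ·∇ + μa + μs - μs K) φ = q` in `X`, `φ = q_b` on `Γ₋`.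
The class of `φ` has a representative `u` which, along almost every characteristic line, is
locally absolutely continuous, has directional derivative
`θ·∇u = q - (μa + μs) u + μs K u` at almost every point of the line inside `Ω`, and has limit
`q_b` at the point where the line enters `Ω`. -/
structure IsRTESolution (Ω : Set (Space d)) (f : Dir d → Dir d → ℝ) (p : ℝ≥0∞)
    (μa μs : Space d → ℝ) (q qb φ : Space d × Dir d → ℝ) : Prop where
  memLp : MemLp φ p (phaseMeasure Ω)
  exists_rep : ∃ u : Space d × Dir d → ℝ, u =ᵐ[phaseMeasure Ω] φ ∧
    ∀ᵐ z ∂(phaseMeasure Ω),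
      (∀ a b : ℝ, a ≤ b → (∀ t ∈ Icc a b, (flow z t).1 ∈ Ω) →
        AbsolutelyContinuousOnInterval (fun t => u (flow z t)) a b) ∧
      (∀ᵐ t : ℝ, (flow z t).1 ∈ Ω →
        HasDerivAt (fun s => u (flow z s))
          (q (flow z t) - (μa (flow z t).1 + μs (flow z t).1) * u (flow z t)
            + μs (flow z t).1 * scatter f u (flow z t)) t) ∧
      Tendsto (fun t => u (flow z t)) (𝓝[>] (-backTime Ω z)) (𝓝 (inflowExt Ω qb z))

/-- The known data of the problem: the domain, the scattering kernel, the coefficients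
`μ_{a,xi}`, `μ_{s,x}`, `μ_{a,m}`, `μ_{s,m}`, the quantum efficiency `η` and the boundary
source `q_b`. -/
structure Medium (d : ℕ) where
  Ω : Set (Space d)
  f : Dir d → Dir d → ℝ
  μaxi : Space d → ℝ
  μsx : Space d → ℝ
  μam : Space d → ℝ
  μsm : Space d → ℝ
  η : Space d → ℝ
  qb : Space d × Dir d → ℝ

/-- The standing assumptions on the data. -/
structure Medium.Admissible (M : Medium d) (p : ℝ≥0∞) (c₁ c₂ : ℝ) : Prop where
  isOpen : IsOpen M.Ω
  isBounded : Bornology.IsBounded M.Ω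
  convex : Convex ℝ M.Ω
  kernel : IsScatteringKernel M.f
  c₁_pos : 0 < c₁
  μaxi : IsCoeff M.Ω c₁ c₂ M.μaxi
  μsx : IsCoeff M.Ω c₁ c₂ M.μsx
  μam : IsCoeff M.Ω c₁ c₂ M.μam
  μsm : IsCoeff M.Ω c₁ c₂ M.μsm
  η_meas : AEStronglyMeasurable M.η (volume.restrict M.Ω)
  η_bounds : ∀ᵐ x ∂(volume.restrict M.Ω), 0 ≤ M.η x ∧ M.η x < 1
  qb_memLp : MemLp (inflowExt M.Ω M.qb) p (phaseMeasure M.Ω)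
  qb_pos : ∀ᵐ z ∂(phaseMeasure M.Ω), 0 < inflowExt M.Ω M.qb z

/-- `φx` solves the excitation equation with fluorophore absorption coefficient `μ`. -/
def Medium.IsExcitation (M : Medium d) (p : ℝ≥0∞) (μ : Space d → ℝ)
    (φx : Space d × Dir d → ℝ) : Prop :=
  IsRTESolution M.Ω M.f p (fun x => M.μaxi x + μ x) M.μsx (fun _ => 0) M.qb φx

/-- `φm` solves the emission equation with source `η μ (Ã φx)` and zero inflow. -/
def Medium.IsEmission (M : Medium d) (p : ℝ≥0∞) (μ : Space d → ℝ)
    (φx φm : Space d × Dir d → ℝ) : Prop :=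
  IsRTESolution M.Ω M.f p M.μam M.μsm (fun z => M.η z.1 * μ z.1 * angularMean φx z.1)
    (fun _ => 0) φm

/-- `(φx, φm)` solves the coupled system for the fluorophore absorption coefficient `μ`. -/
def Medium.IsSolution (M : Medium d) (p : ℝ≥0∞) (μ : Space d → ℝ)
    (φx φm : Space d × Dir d → ℝ) : Prop :=
  M.IsExcitation p μ φx ∧ M.IsEmission p μ φx φm

/-- The absorbed energy `h = (μ_{a,xi} + (1 - η) μ) A φx + μ_{a,m} A φm`. -/
def Medium.energy (M : Medium d) (μ : Space d → ℝ) (φx φm : Space d × Dir d → ℝ)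
    (x : Space d) : ℝ :=
  (M.μaxi x + (1 - M.η x) * μ x) * angularInt φx x + M.μam x * angularInt φm x

/-- The update `(1 / (1 - η)) ((h - μ_{a,m} A φm) / (A φx) - μ_{a,xi})`. -/
def Medium.update (M : Medium d) (h : Space d → ℝ) (φx φm : Space d × Dir d → ℝ)
    (x : Space d) : ℝ :=
  1 / (1 - M.η x) * ((h x - M.μam x * angularInt φm x) / angularInt φx x - M.μaxi x)

/-- The six sequences of the squeeze iteration (`lo` for underlined, `hi` for overlined). -/
structure Iterates (d : ℕ) where
  μlo : ℕ → Space d → ℝ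
  μhi : ℕ → Space d → ℝ
  φxlo : ℕ → Space d × Dir d → ℝ
  φxhi : ℕ → Space d × Dir d → ℝ
  φmlo : ℕ → Space d × Dir d → ℝ
  φmhi : ℕ → Space d × Dir d → ℝ

/-- The six sequences are produced by the squeeze iteration from the data `h`, started at the
constants `c₁` and `c₂` and run forever. -/
structure Medium.IsSIM (M : Medium d) (p : ℝ≥0∞) (c₁ c₂ : ℝ) (h : Space d → ℝ)
    (s : Iterates d) : Prop where
  lo_zero : ∀ᵐ x ∂(volume.restrict M.Ω), s.μlo 0 x = c₁
  hi_zero : ∀ᵐ x ∂(volume.restrict M.Ω), s.μhi 0 x = c₂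
  excitation_lo : ∀ i, M.IsExcitation p (s.μlo i) (s.φxlo i)
  excitation_hi : ∀ i, M.IsExcitation p (s.μhi i) (s.φxhi i)
  emission_hi : ∀ i, M.IsEmission p (s.μhi i) (s.φxlo i) (s.φmhi i)
  emission_lo : ∀ i, M.IsEmission p (s.μlo i) (s.φxhi i) (s.φmlo i)
  lo_succ : ∀ i, ∀ᵐ x ∂(volume.restrict M.Ω),
    s.μlo (i + 1) x = max (s.μlo i x) (M.update h (s.φxlo i) (s.φmhi i) x)
  hi_succ : ∀ i, ∀ᵐ x ∂(volume.restrict M.Ω),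
    s.μhi (i + 1) x = min (s.μhi i x) (M.update h (s.φxhi i) (s.φmlo i) x)

end FPAT

end

/-!
Adding a large constant attenuation `C` and integrating along characteristics turns the transport
equation into a fixed point equation `φ = J + S φ`, where `S` streams the collision source
`(C - μa - μs) φ + μs K φ` with attenuation `C`. The operator `S` is positive, and since `f` is
symmetric with unit mass and `μa ≥ a > 0`, its kernel has mass at most `(C - a) / C < 1` in either
variable. By Schur's test it is a contraction of every `L^p`, so the equation is uniquely solvable
and its solution inherits the sign of the data.

The difference of two solutions with absorptions `μ₁ ≤ μ₂` solves the first equation with source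
`(μ₂ - μ₁) φ₂`, so the excitation decreases and the emission increases with the fluorophore
absorption. The update is a decreasing function of both fields and returns `μ*` at the true ones;
hence it maps upper bounds for the fields to lower bounds for `μ*`, and conversely.
-/

noncomputable section

namespace FPAT

open ProbabilityTheory
open scoped NNReal

section KernelBounds

variable {α β : Type*} {mα : MeasurableSpace α} {mβ : MeasurableSpace β}

theorem lintegral_rpow_le_mul_lintegral_rpow {m : Measure α} {K : ℝ≥0∞} (hK : m univ ≤ K) {r : ℝ}
    (hr : 1 ≤ r) {g : α → ℝ≥0∞} (hg : AEMeasurable g m) :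
    (∫⁻ a, g a ∂m) ^ r ≤ K ^ (r - 1) * ∫⁻ a, g a ^ r ∂m := by
  have hr0 : 0 < r := by positivity
  have h := eLpNorm'_le_eLpNorm'_mul_rpow_measure_univ one_pos hr hg.aestronglyMeasurable
  simp only [eLpNorm', enorm_eq_self, ENNReal.rpow_one, div_one] at h
  calc (∫⁻ a, g a ∂m) ^ r
      ≤ ((∫⁻ a, g a ^ r ∂m) ^ (1 / r) * m univ ^ (1 - 1 / r)) ^ r := by gcongr
    _ = m univ ^ (r - 1) * ∫⁻ a, g a ^ r ∂m := by
        rw [ENNReal.mul_rpow_of_nonneg _ _ hr0.le, ← ENNReal.rpow_mul, ← ENNReal.rpow_mul,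
          one_div_mul_cancel hr0.ne', ENNReal.rpow_one, sub_mul, one_div_mul_cancel hr0.ne',
          one_mul, mul_comm]
    _ ≤ K ^ (r - 1) * ∫⁻ a, g a ^ r ∂m := by gcongr

variable {κ : Kernel α β} {μ : Measure α} {ν : Measure β} {K : ℝ≥0∞}

theorem eLpNormEssSup_lintegral_kernel_le (hmass : ∀ᵐ a ∂μ, κ a univ ≤ K)
    (hcomp : κ ∘ₘ μ ≪ ν) (g : β → ℝ≥0∞) :
    eLpNormEssSup (fun a => ∫⁻ b, g b ∂κ a) μ ≤ K * eLpNormEssSup g ν := by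
  have hg : ∀ᵐ a ∂μ, ∀ᵐ b ∂κ a, g b ≤ eLpNormEssSup g ν :=
    Measure.ae_ae_of_ae_comp (hcomp.ae_le (enorm_ae_le_eLpNormEssSup g ν))
  refine essSup_le_of_ae_le _ ?_
  filter_upwards [hmass, hg] with a ha hga
  calc ∫⁻ b, g b ∂κ a ≤ ∫⁻ _, eLpNormEssSup g ν ∂κ a := lintegral_mono_ae hga
    _ = κ a univ * eLpNormEssSup g ν := by rw [lintegral_const, mul_comm]
    _ ≤ K * eLpNormEssSup g ν := by gcongr

theorem lintegral_lintegral_kernel_rpow_le (hmass : ∀ᵐ a ∂μ, κ a univ ≤ K)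
    (hcomp : κ ∘ₘ μ ≤ K • ν) {r : ℝ} (hr : 1 ≤ r) {g : β → ℝ≥0∞} (hg : Measurable g) :
    ∫⁻ a, (∫⁻ b, g b ∂κ a) ^ r ∂μ ≤ K ^ r * ∫⁻ b, g b ^ r ∂ν := by
  calc ∫⁻ a, (∫⁻ b, g b ∂κ a) ^ r ∂μ
      ≤ ∫⁻ a, K ^ (r - 1) * ∫⁻ b, g b ^ r ∂κ a ∂μ := by
        refine lintegral_mono_ae (hmass.mono fun a ha => ?_)
        exact lintegral_rpow_le_mul_lintegral_rpow ha hr hg.aemeasurable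
    _ = K ^ (r - 1) * ∫⁻ b, g b ^ r ∂(κ ∘ₘ μ) := by
        rw [lintegral_const_mul _ (hg.pow_const r).lintegral_kernel,
          Measure.lintegral_bind κ.aemeasurable (hg.pow_const r).aemeasurable]
    _ ≤ K ^ (r - 1) * ∫⁻ b, g b ^ r ∂(K • ν) := by gcongr
    _ = K ^ r * ∫⁻ b, g b ^ r ∂ν := by
        rw [lintegral_smul_measure, smul_eq_mul, ← mul_assoc]
        nth_rewrite 2 [← ENNReal.rpow_one K]
        rw [← ENNReal.rpow_add_of_nonneg _ _ (by linarith) zero_le_one, sub_add_cancel]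

theorem eLpNorm_lintegral_kernel_le (hmass : ∀ᵐ a ∂μ, κ a univ ≤ K)
    (hcomp : κ ∘ₘ μ ≤ K • ν) {p : ℝ≥0∞} (hp : 1 ≤ p) {g : β → ℝ≥0∞} (hg : Measurable g) :
    eLpNorm (fun a => ∫⁻ b, g b ∂κ a) p μ ≤ K * eLpNorm g p ν := by
  rcases eq_or_ne p ∞ with rfl | hp'
  · simp only [eLpNorm_exponent_top]
    exact eLpNormEssSup_lintegral_kernel_le hmass
      (hcomp.absolutelyContinuous.trans Measure.smul_absolutelyContinuous) g
  have hp0 : p ≠ 0 := (one_pos.trans_le hp).ne'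
  have hr : 1 ≤ p.toReal := by simpa using ENNReal.toReal_mono hp' hp
  have hr0 : 0 < p.toReal := by linarith
  simp only [eLpNorm_eq_lintegral_rpow_enorm_toReal hp0 hp', enorm_eq_self]
  calc (∫⁻ a, (∫⁻ b, g b ∂κ a) ^ p.toReal ∂μ) ^ (1 / p.toReal)
      ≤ (K ^ p.toReal * ∫⁻ b, g b ^ p.toReal ∂ν) ^ (1 / p.toReal) := by
        gcongr
        exact lintegral_lintegral_kernel_rpow_le hmass hcomp hr hg
    _ = K * (∫⁻ b, g b ^ p.toReal ∂ν) ^ (1 / p.toReal) := by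
        rw [ENNReal.mul_rpow_of_nonneg _ _ (by positivity), ← ENNReal.rpow_mul,
          mul_one_div_cancel hr0.ne', ENNReal.rpow_one]

end KernelBounds

section FixedPoint

variable {α : Type*} [MeasurableSpace α] {m : Measure α} {p B : ℝ≥0∞}

theorem eLpNormEssSup_iSup_le {g : ℕ → α → ℝ≥0∞} (hB : ∀ n, eLpNormEssSup (g n) m ≤ B) :
    eLpNormEssSup (fun z => ⨆ n, g n z) m ≤ B := by
  have h : ∀ᵐ z ∂m, ∀ n, g n z ≤ B :=
    ae_all_iff.2 fun n => (enorm_ae_le_eLpNormEssSup (g n) m).mono fun _ hz => hz.trans (hB n)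
  exact essSup_le_of_ae_le _ (h.mono fun _ hz => iSup_le hz)

theorem eLpNorm_iSup_le {g : ℕ → α → ℝ≥0∞} (hg : ∀ n, Measurable (g n)) (hmono : Monotone g)
    (hB : ∀ n, eLpNorm (g n) p m ≤ B) : eLpNorm (fun z => ⨆ n, g n z) p m ≤ B := by
  rcases eq_or_ne p ∞ with rfl | hp'
  · simp only [eLpNorm_exponent_top] at hB ⊢
    exact eLpNormEssSup_iSup_le hB
  rcases eq_or_ne p 0 with rfl | hp0
  · simp
  have hr : 0 < p.toReal := ENNReal.toReal_pos hp0 hp'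
  have hsup : ∀ z, (⨆ n, g n z) ^ p.toReal = ⨆ n, g n z ^ p.toReal := fun z =>
    (ENNReal.orderIsoRpow p.toReal hr).map_iSup _
  simp only [eLpNorm_eq_lintegral_rpow_enorm_toReal hp0 hp', enorm_eq_self, one_div,
    ENNReal.rpow_inv_le_iff hr, hsup] at hB ⊢
  rw [lintegral_iSup (fun n => (hg n).pow_const _)
    fun i j hij z => ENNReal.rpow_le_rpow (hmono hij z) hr.le]
  exact iSup_le hB

theorem exists_measurable_fixedPoint_eLpNorm_le {T : (α → ℝ≥0∞) → α → ℝ≥0∞} (hT : Monotone T)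
    (hmeas : ∀ g, Measurable g → Measurable (T g))
    (hsup : ∀ g : ℕ → α → ℝ≥0∞, (∀ n, Measurable (g n)) → Monotone g → T (⨆ n, g n) = ⨆ n, T (g n))
    (hB : ∀ g, Measurable g → eLpNorm g p m ≤ B → eLpNorm (T g) p m ≤ B) :
    ∃ Φ, Measurable Φ ∧ T Φ = Φ ∧ eLpNorm Φ p m ≤ B := by
  have hmono : Monotone fun n => T^[n] 0 := hT.monotone_iterate_of_le_map bot_le
  have hiter : ∀ n, Measurable (T^[n] 0) ∧ eLpNorm (T^[n] 0) p m ≤ B := fun n => by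
    induction n with
    | zero => exact ⟨measurable_zero, by simp⟩
    | succ n ih =>
      rw [Function.iterate_succ_apply']
      exact ⟨hmeas _ ih.1, hB _ ih.1 ih.2⟩
  have happly : (⨆ n, T^[n] 0) = fun z => ⨆ n, T^[n] 0 z := funext fun z => iSup_apply
  refine ⟨⨆ n, T^[n] 0, ?_, ?_, ?_⟩
  · exact happly ▸ Measurable.iSup fun n => (hiter n).1
  · rw [hsup _ (fun n => (hiter n).1) hmono, ← hmono.iSup_nat_add 1]
    simp only [Function.iterate_succ_apply']
  · exact happly ▸ eLpNorm_iSup_le (fun n => (hiter n).1) hmono fun n => (hiter n).2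

end FixedPoint

variable {d : ℕ}

section Flow

instance : IsFiniteMeasure (angularMeasure d) := by
  unfold angularMeasure; infer_instance

/-- The measure `dx dθ` on the space of all positions and directions, which the flow preserves. -/
def fullMeasure (d : ℕ) : Measure (Space d × Dir d) :=
  (volume : Measure (Space d)).prod (angularMeasure d)

instance : SFinite (fullMeasure d) := by unfold fullMeasure; infer_instance

instance (Ω : Set (Space d)) : SFinite (phaseMeasure Ω) := by unfold phaseMeasure; infer_instance

variable {Ω : Set (Space d)}

theorem isFiniteMeasure_phaseMeasure (hΩ : Bornology.IsBounded Ω) :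
    IsFiniteMeasure (phaseMeasure Ω) := by
  have : IsFiniteMeasure ((volume : Measure (Space d)).restrict Ω) :=
    isFiniteMeasure_restrict.2 hΩ.measure_lt_top.ne
  unfold phaseMeasure; infer_instance

theorem phaseMeasure_eq_restrict (Ω : Set (Space d)) :
    phaseMeasure Ω = (fullMeasure d).restrict (Prod.fst ⁻¹' Ω) := by
  rw [← Set.prod_univ, fullMeasure, ← Measure.prod_restrict, Measure.restrict_univ, phaseMeasure]

theorem phaseMeasure_le_fullMeasure (Ω : Set (Space d)) : phaseMeasure Ω ≤ fullMeasure d :=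
  phaseMeasure_eq_restrict Ω ▸ Measure.restrict_le_self

theorem ae_phaseMeasure_mem (hΩ : MeasurableSet Ω) : ∀ᵐ z ∂(phaseMeasure Ω), z.1 ∈ Ω :=
  phaseMeasure_eq_restrict Ω ▸ ae_restrict_mem (measurable_fst hΩ)

theorem ae_phaseMeasure_of_ae {P : Space d → Prop} (h : ∀ᵐ x ∂(volume.restrict Ω), P x) :
    ∀ᵐ z ∂(phaseMeasure Ω), P z.1 :=
  Measure.quasiMeasurePreserving_fst.ae h

theorem measurable_flow : Measurable fun p : (Space d × Dir d) × ℝ => flow p.1 p.2 := by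
  unfold flow
  fun_prop

theorem measurable_flow_right (z : Space d × Dir d) : Measurable (flow z) :=
  measurable_flow.comp measurable_prodMk_left

theorem flow_flow (z : Space d × Dir d) (s t : ℝ) : flow (flow z s) t = flow z (s + t) := by
  simp [flow, add_smul, add_assoc]

@[simp] theorem flow_zero (z : Space d × Dir d) : flow z 0 = z := by simp [flow]

theorem measurePreserving_flow (t : ℝ) :
    MeasurePreserving (fun z : Space d × Dir d => flow z t) (fullMeasure d) (fullMeasure d) := by
  have hskew : MeasurePreserving (fun q : Dir d × Space d => (id q.1, q.2 + t • (q.1 : Space d)))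
      ((angularMeasure d).prod volume) ((angularMeasure d).prod volume) :=
    MeasurePreserving.skew_product (g := fun (θ : Dir d) (x : Space d) => x + t • (θ : Space d))
      (MeasurePreserving.id _) (by unfold Function.uncurry; fun_prop)
      (ae_of_all _ fun θ => (measurePreserving_add_right volume (t • (θ : Space d))).map_eq)
  exact (Measure.measurePreserving_swap.comp hskew).comp Measure.measurePreserving_swap

theorem quasiMeasurePreserving_flow :
    Measure.QuasiMeasurePreserving (fun p : (Space d × Dir d) × ℝ => flow p.1 p.2)
      ((fullMeasure d).prod volume) (fullMeasure d) :=
  QuasiMeasurePreserving.prod_of_left measurable_flow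
    (ae_of_all _ fun t => (measurePreserving_flow t).quasiMeasurePreserving)

theorem ae_ae_flow_of_ae (hΩ : MeasurableSet Ω) {P : Space d × Dir d → Prop}
    (h : ∀ᵐ z ∂(phaseMeasure Ω), P z) :
    ∀ᵐ z ∂(phaseMeasure Ω), ∀ᵐ t : ℝ, (flow z t).1 ∈ Ω → P (flow z t) := by
  rw [phaseMeasure_eq_restrict, ae_restrict_iff' (measurable_fst hΩ)] at h
  exact (phaseMeasure_le_fullMeasure Ω).absolutelyContinuous.ae_le
    (Measure.ae_ae_of_ae_prod (quasiMeasurePreserving_flow.ae h))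

theorem measurePreserving_id_prod_flow (m : Measure ℝ) [SFinite m] :
    MeasurePreserving (fun p : ℝ × (Space d × Dir d) => (p.1, flow p.2 p.1))
      (m.prod (fullMeasure d)) (m.prod (fullMeasure d)) :=
  (MeasurePreserving.id m).skew_product (g := fun t z => flow z t)
    (measurable_flow.comp measurable_swap)
    (ae_of_all _ fun t => (measurePreserving_flow t).map_eq)

theorem ae_locallyIntegrable_indicator_flow (hΩ : MeasurableSet Ω) {G : Space d × Dir d → ℝ}
    (hG : Integrable G (phaseMeasure Ω)) :
    ∀ᵐ z ∂(phaseMeasure Ω),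
      LocallyIntegrable fun t => (Prod.fst ⁻¹' Ω).indicator G (flow z t) := by
  rw [phaseMeasure_eq_restrict, ← IntegrableOn,
    ← integrable_indicator_iff (measurable_fst hΩ)] at hG
  have hball : ∀ n : ℕ, ∀ᵐ z ∂(fullMeasure d),
      IntegrableOn (fun t => (Prod.fst ⁻¹' Ω).indicator G (flow z t))
        (Metric.closedBall 0 (n : ℝ)) := fun n => by
    have : IsFiniteMeasure ((volume : Measure ℝ).restrict (Metric.closedBall 0 n)) :=
      isFiniteMeasure_restrict.2 measure_closedBall_lt_top.ne
    exact ((measurePreserving_id_prod_flow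
      (volume.restrict (Metric.closedBall 0 (n : ℝ)))).integrable_comp_of_integrable
        (hG.comp_snd _)).prod_left_ae
  refine (phaseMeasure_le_fullMeasure Ω).absolutelyContinuous.ae_le ?_
  filter_upwards [ae_all_iff.2 hball] with z hz
  refine locallyIntegrable_iff.2 fun K hK => ?_
  obtain ⟨R, hR⟩ := hK.isBounded.subset_closedBall (0 : ℝ)
  obtain ⟨n, hn⟩ := exists_nat_ge R
  exact (hz n).mono_set (hR.trans (Metric.closedBall_subset_closedBall hn))

end Flow

section Streaming

/-- The measure `e^{Ct} dt` on the half-line of negative times. -/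
def decayMeasure (C : ℝ) : Measure ℝ :=
  (volume.restrict (Iio 0)).withDensity fun t => ENNReal.ofReal (Real.exp (C * t))

instance (C : ℝ) : SFinite (decayMeasure C) := by unfold decayMeasure; infer_instance

/-- The kernel `z ↦ ∫_{t < 0} e^{Ct} δ_{z + tθ} dt`, by which a source travels along the
characteristic lines under the constant attenuation `C`. -/
def streamKernel (d : ℕ) (C : ℝ) : Kernel (Space d × Dir d) (Space d × Dir d) where
  toFun z := (decayMeasure C).map (flow z)
  measurable' := Measure.measurable_of_measurable_coe _ fun s hs => by
    simp only [Measure.map_apply (measurable_flow_right _) hs]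
    exact measurable_measure_prodMk_left (measurable_flow hs)

theorem streamKernel_apply (C : ℝ) (z : Space d × Dir d) :
    streamKernel d C z = (decayMeasure C).map (flow z) := rfl

theorem decayMeasure_univ {C : ℝ} (hC : 0 < C) : decayMeasure C univ = (ENNReal.ofReal C)⁻¹ := by
  rw [decayMeasure, withDensity_apply _ .univ, Measure.restrict_univ,
    ← Measure.restrict_congr_set Iio_ae_eq_Iic.symm,
    ← ofReal_integral_eq_lintegral_ofReal (integrableOn_exp_mul_Iic hC 0)
      (ae_of_all _ fun t => (Real.exp_pos _).le), integral_exp_mul_Iic hC,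
    mul_zero, Real.exp_zero, one_div, ENNReal.ofReal_inv_of_pos hC]

theorem streamKernel_univ (C : ℝ) (z : Space d × Dir d) :
    streamKernel d C z univ = decayMeasure C univ := by
  rw [streamKernel_apply, Measure.map_apply (measurable_flow_right z) .univ, preimage_univ]

theorem streamKernel_comp_fullMeasure (d : ℕ) (C : ℝ) :
    streamKernel d C ∘ₘ fullMeasure d = decayMeasure C univ • fullMeasure d := by
  ext s hs
  have hpre : MeasurableSet ((fun p : (Space d × Dir d) × ℝ => flow p.1 p.2) ⁻¹' s) :=
    measurable_flow hs
  calc (streamKernel d C ∘ₘ fullMeasure d) s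
      = ∫⁻ z, decayMeasure C (flow z ⁻¹' s) ∂(fullMeasure d) := by
        simp only [Measure.bind_apply hs (streamKernel d C).aemeasurable, streamKernel_apply,
          Measure.map_apply (measurable_flow_right _) hs]
    _ = ((fullMeasure d).prod (decayMeasure C)) ((fun p => flow p.1 p.2) ⁻¹' s) :=
        (Measure.prod_apply hpre).symm
    _ = ∫⁻ t, fullMeasure d ((fun z => flow z t) ⁻¹' s) ∂(decayMeasure C) :=
        Measure.prod_apply_symm hpre
    _ = (decayMeasure C univ • fullMeasure d) s := by
        simp only [(measurePreserving_flow _).measure_preimage hs.nullMeasurableSet,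
          lintegral_const, Measure.smul_apply, smul_eq_mul, mul_comm]

/-- The field in `Ω` produced by the source `g` under the constant attenuation `C`, without
inflow. -/
def streamed (C : ℝ) (Ω : Set (Space d)) (g : Space d × Dir d → ℝ≥0∞) (z : Space d × Dir d) :
    ℝ≥0∞ :=
  ∫⁻ y in Prod.fst ⁻¹' Ω, g y ∂(streamKernel d C z)

variable {C : ℝ} {Ω : Set (Space d)} {g : Space d × Dir d → ℝ≥0∞}

theorem streamed_eq_lintegral_indicator (hΩ : MeasurableSet Ω) (g : Space d × Dir d → ℝ≥0∞) :
    streamed C Ω g = fun z => ∫⁻ y, (Prod.fst ⁻¹' Ω).indicator g y ∂(streamKernel d C z) :=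
  funext fun _ => (lintegral_indicator (measurable_fst hΩ) g).symm

theorem measurable_streamed (hΩ : MeasurableSet Ω) (hg : Measurable g) :
    Measurable (streamed C Ω g) := by
  rw [streamed_eq_lintegral_indicator hΩ]
  exact (hg.indicator (measurable_fst hΩ)).lintegral_kernel

theorem eLpNorm_streamed_le (hC : 0 < C) (hΩ : MeasurableSet Ω) {p : ℝ≥0∞} (hp : 1 ≤ p)
    (hg : Measurable g) :
    eLpNorm (streamed C Ω g) p (phaseMeasure Ω)
      ≤ (ENNReal.ofReal C)⁻¹ * eLpNorm g p (phaseMeasure Ω) := by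
  have hS : MeasurableSet (Prod.fst ⁻¹' Ω : Set (Space d × Dir d)) := measurable_fst hΩ
  calc eLpNorm (streamed C Ω g) p (phaseMeasure Ω)
      ≤ eLpNorm (streamed C Ω g) p (fullMeasure d) :=
        eLpNorm_mono_measure _ (phaseMeasure_le_fullMeasure Ω)
    _ ≤ decayMeasure C univ * eLpNorm ((Prod.fst ⁻¹' Ω).indicator g) p (fullMeasure d) := by
        rw [streamed_eq_lintegral_indicator hΩ]
        exact eLpNorm_lintegral_kernel_le (ae_of_all _ fun z => (streamKernel_univ C z).le)
          (streamKernel_comp_fullMeasure d C).le hp (hg.indicator hS)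
    _ = (ENNReal.ofReal C)⁻¹ * eLpNorm g p (phaseMeasure Ω) := by
        rw [decayMeasure_univ hC, eLpNorm_indicator_eq_eLpNorm_restrict hS,
          phaseMeasure_eq_restrict]

end Streaming

section Geometry

/-- The domains in which transport is considered: open, bounded and convex sets. -/
structure IsConvexDomain (Ω : Set (Space d)) : Prop where
  isOpen : IsOpen Ω
  isBounded : Bornology.IsBounded Ω
  convex : Convex ℝ Ω

variable {Ω : Set (Space d)} {z : Space d × Dir d} {t : ℝ}

theorem ordConnected_setOf_flow_mem (hΩ : Convex ℝ Ω) (z : Space d × Dir d) :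
    OrdConnected {t : ℝ | (flow z t).1 ∈ Ω} := by
  have hpre : {t : ℝ | (flow z t).1 ∈ Ω}
      = (AffineMap.lineMap z.1 (z.1 + (z.2 : Space d)) : ℝ →ᵃ[ℝ] Space d) ⁻¹' Ω := by
    ext s
    simp [flow, AffineMap.lineMap_apply, add_comm]
  exact hpre ▸ (hΩ.affine_preimage _).ordConnected

theorem isOpen_setOf_flow_mem (hΩ : IsOpen Ω) (z : Space d × Dir d) :
    IsOpen {t : ℝ | (flow z t).1 ∈ Ω} :=
  hΩ.preimage (by unfold flow; fun_prop)

theorem backTime_eq_sSup_flow (Ω : Set (Space d)) (z : Space d × Dir d) :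
    backTime Ω z = sSup {t : ℝ | 0 ≤ t ∧ (flow z (-t)).1 ∈ Ω} := by
  simp only [backTime, flow, neg_smul, sub_eq_add_neg]

theorem bddAbove_setOf_flow_neg_mem (hΩ : Bornology.IsBounded Ω) (z : Space d × Dir d) :
    BddAbove {t : ℝ | 0 ≤ t ∧ (flow z (-t)).1 ∈ Ω} := by
  obtain ⟨R, hR⟩ := hΩ.exists_norm_le
  refine ⟨‖z.1‖ + R, fun t ht => ?_⟩
  calc t = ‖z.1 - (flow z (-t)).1‖ := by
        simp [flow, norm_smul, Real.norm_of_nonneg ht.1]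
    _ ≤ ‖z.1‖ + ‖(flow z (-t)).1‖ := norm_sub_le _ _
    _ ≤ ‖z.1‖ + R := by gcongr; exact hR _ ht.2

namespace IsConvexDomain

theorem flow_mem_iff_of_nonpos (hΩ : IsConvexDomain Ω) (hz : z.1 ∈ Ω) (ht : t ≤ 0) :
    (flow z t).1 ∈ Ω ↔ -backTime Ω z < t := by
  rw [backTime_eq_sSup_flow]
  constructor
  · intro h
    obtain ⟨s, hst, hs⟩ := mem_nhdsLE_iff_exists_Ioc_subset.1
      (nhdsWithin_le_nhds ((isOpen_setOf_flow_mem hΩ.isOpen z).mem_nhds h))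
    obtain ⟨r, hsr, hrt⟩ := exists_between (mem_Iio.1 hst)
    have hr : -r ≤ sSup {t : ℝ | 0 ≤ t ∧ (flow z (-t)).1 ∈ Ω} :=
      le_csSup (bddAbove_setOf_flow_neg_mem hΩ.isBounded z)
        ⟨by linarith, by rw [neg_neg]; exact hs ⟨hsr, hrt.le⟩⟩
    linarith
  · intro h
    obtain ⟨s, hs, hts⟩ := exists_lt_of_lt_csSup
      (show {t : ℝ | 0 ≤ t ∧ (flow z (-t)).1 ∈ Ω}.Nonempty from ⟨0, le_rfl, by simpa⟩) (neg_lt.1 h)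
    exact (ordConnected_setOf_flow_mem hΩ.convex z).out hs.2
      (show (flow z 0).1 ∈ Ω by simpa) ⟨by linarith, ht⟩

theorem backTime_pos (hΩ : IsConvexDomain Ω) (hz : z.1 ∈ Ω) : 0 < backTime Ω z := by
  have := (hΩ.flow_mem_iff_of_nonpos hz le_rfl).1 (by simpa)
  linarith

theorem flow_mem_of_mem_Ioc (hΩ : IsConvexDomain Ω) (hz : z.1 ∈ Ω)
    (ht : t ∈ Ioc (-backTime Ω z) 0) : (flow z t).1 ∈ Ω :=
  (hΩ.flow_mem_iff_of_nonpos hz ht.2).2 ht.1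

theorem flow_mem_iff_of_le (hΩ : IsConvexDomain Ω) (hz : z.1 ∈ Ω) {b : ℝ}
    (hb : (flow z b).1 ∈ Ω) (ht : t ≤ b) : (flow z t).1 ∈ Ω ↔ -backTime Ω z < t := by
  rcases le_total t 0 with h | h
  · exact hΩ.flow_mem_iff_of_nonpos hz h
  · exact iff_of_true ((ordConnected_setOf_flow_mem hΩ.convex z).out
      (show (flow z 0).1 ∈ Ω by simpa) hb ⟨h, ht⟩) (by linarith [hΩ.backTime_pos hz])

theorem neg_backTime_lt (hΩ : IsConvexDomain Ω) (hz : z.1 ∈ Ω) (ht : (flow z t).1 ∈ Ω) :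
    -backTime Ω z < t :=
  (hΩ.flow_mem_iff_of_le hz ht le_rfl).1 ht

theorem setOf_flow_mem_mem_nhdsGT (hΩ : IsConvexDomain Ω) (hz : z.1 ∈ Ω) :
    {t : ℝ | (flow z t).1 ∈ Ω} ∈ 𝓝[>] (-backTime Ω z) :=
  mem_of_superset (Ioc_mem_nhdsGT (neg_lt_zero.2 (hΩ.backTime_pos hz)))
    fun _ ht => hΩ.flow_mem_of_mem_Ioc hz ht

theorem backTime_flow (hΩ : IsConvexDomain Ω) (hz : z.1 ∈ Ω) (ht : (flow z t).1 ∈ Ω) :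
    backTime Ω (flow z t) = backTime Ω z + t := by
  have hset : {s : ℝ | 0 ≤ s ∧ (flow (flow z t) (-s)).1 ∈ Ω} = Ico 0 (backTime Ω z + t) := by
    ext s
    refine and_congr_right fun hs => ?_
    rw [flow_flow, hΩ.flow_mem_iff_of_le hz ht (by linarith)]
    constructor <;> intro h <;> linarith
  rw [backTime_eq_sSup_flow, hset, csSup_Ico (by linarith [hΩ.neg_backTime_lt hz ht])]

theorem inflowExt_flow (hΩ : IsConvexDomain Ω) (qb : Space d × Dir d → ℝ) (hz : z.1 ∈ Ω)
    (ht : (flow z t).1 ∈ Ω) : inflowExt Ω qb (flow z t) = inflowExt Ω qb z := by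
  rw [inflowExt, inflowPoint, hΩ.backTime_flow hz ht, inflowExt, inflowPoint]
  congr 2
  simp only [flow, add_smul]
  abel

theorem preimage_flow_inter_Iio (hΩ : IsConvexDomain Ω) (hz : z.1 ∈ Ω) :
    flow z ⁻¹' (Prod.fst ⁻¹' Ω) ∩ Iio 0 = Ioo (-backTime Ω z) 0 := by
  ext t
  exact and_congr_left fun ht => hΩ.flow_mem_iff_of_nonpos hz (mem_Iio.1 ht).le

theorem ae_restrict_Ioo_flow_of_ae (hΩ : IsConvexDomain Ω) {P : Space d × Dir d → Prop}
    (h : ∀ᵐ z ∂(phaseMeasure Ω), P z) :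
    ∀ᵐ z ∂(phaseMeasure Ω), ∀ᵐ t ∂(volume.restrict (Ioo (-backTime Ω z) 0)), P (flow z t) := by
  filter_upwards [ae_phaseMeasure_mem hΩ.isOpen.measurableSet,
    ae_ae_flow_of_ae hΩ.isOpen.measurableSet h] with z hz hflow
  filter_upwards [ae_restrict_of_ae hflow, ae_restrict_mem measurableSet_Ioo] with t ht htm
  exact ht (hΩ.flow_mem_of_mem_Ioc hz (Ioo_subset_Ioc_self htm))

theorem ae_integrableOn_flow (hΩ : IsConvexDomain Ω) {G : Space d × Dir d → ℝ}
    (hG : Integrable G (phaseMeasure Ω)) :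
    ∀ᵐ z ∂(phaseMeasure Ω), IntegrableOn (fun t => G (flow z t)) (Ioo (-backTime Ω z) 0) := by
  filter_upwards [ae_phaseMeasure_mem hΩ.isOpen.measurableSet,
    ae_locallyIntegrable_indicator_flow hΩ.isOpen.measurableSet hG] with z hz hloc
  refine ((hloc.integrableOn_isCompact isCompact_Icc).mono_set Ioo_subset_Icc_self).congr_fun
    (fun t ht => ?_) measurableSet_Ioo
  exact indicator_of_mem (s := Prod.fst ⁻¹' Ω)
    (hΩ.flow_mem_of_mem_Ioc hz (Ioo_subset_Ioc_self ht)) G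

theorem streamed_eq_setLIntegral (hΩ : IsConvexDomain Ω) (C : ℝ) {g : Space d × Dir d → ℝ≥0∞}
    (hg : Measurable g) (hz : z.1 ∈ Ω) :
    streamed C Ω g z
      = ∫⁻ t in Ioo (-backTime Ω z) 0, ENNReal.ofReal (Real.exp (C * t)) * g (flow z t) := by
  have hS : MeasurableSet (Prod.fst ⁻¹' Ω : Set (Space d × Dir d)) :=
    measurable_fst hΩ.isOpen.measurableSet
  rw [streamed, streamKernel_apply, setLIntegral_map hS hg (measurable_flow_right z), decayMeasure,
    restrict_withDensity (measurable_flow_right z hS),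
    Measure.restrict_restrict (measurable_flow_right z hS), hΩ.preimage_flow_inter_Iio hz,
    lintegral_withDensity_eq_lintegral_mul _ (by fun_prop)
      (show Measurable fun t => g (flow z t) from hg.comp (measurable_flow_right z))]
  simp only [Pi.mul_apply]

theorem aestronglyMeasurable_backTime (hΩ : IsConvexDomain Ω) :
    AEStronglyMeasurable (backTime Ω) (phaseMeasure Ω) := by
  refine ⟨fun z => (streamed 0 Ω (fun _ => 1) z).toReal, (measurable_streamed
    hΩ.isOpen.measurableSet measurable_const).ennreal_toReal.stronglyMeasurable, ?_⟩
  filter_upwards [ae_phaseMeasure_mem hΩ.isOpen.measurableSet] with z hz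
  simp [hΩ.streamed_eq_setLIntegral 0 measurable_const hz, (hΩ.backTime_pos hz).le]

end IsConvexDomain

end Geometry

section DampedEquation

theorem absolutelyContinuousOnInterval_exp_mul (C a b : ℝ) :
    AbsolutelyContinuousOnInterval (fun t : ℝ => Real.exp (C * t)) a b :=
  ContDiffOn.absolutelyContinuousOnInterval (ContDiff.contDiffOn (by fun_prop))

theorem hasDerivAt_exp_mul (C t : ℝ) :
    HasDerivAt (fun s : ℝ => Real.exp (C * s)) (C * Real.exp (C * t)) t := by
  simpa [mul_comm] using ((hasDerivAt_id t).const_mul C).exp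

theorem absolutelyContinuousOnInterval_congr {v w : ℝ → ℝ} {a b : ℝ}
    (hv : AbsolutelyContinuousOnInterval v a b) (h : EqOn v w (uIcc a b)) :
    AbsolutelyContinuousOnInterval w a b := by
  rw [absolutelyContinuousOnInterval_iff] at hv ⊢
  intro ε hε
  obtain ⟨δ, hδ, hv⟩ := hv ε hε
  refine ⟨δ, hδ, fun E hE hlt => lt_of_eq_of_lt (Finset.sum_congr rfl fun i hi => ?_) (hv E hE hlt)⟩
  rw [h (hE.1 i hi).1, h (hE.1 i hi).2]

variable {C : ℝ} {g : ℝ → ℝ}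

theorem locallyIntegrable_exp_mul (C : ℝ) (hg : LocallyIntegrable g) :
    LocallyIntegrable fun t => Real.exp (C * t) * g t := by
  rw [← locallyIntegrableOn_univ] at hg ⊢
  exact hg.continuousOn_mul (by fun_prop) isOpen_univ.isLocallyClosed

theorem integrableOn_exp_mul (C : ℝ) {a b : ℝ} (hg : IntegrableOn g (Ioo a b)) :
    IntegrableOn (fun t => Real.exp (C * t) * g t) (Ioo a b) := by
  rw [← integrableOn_Icc_iff_integrableOn_Ioo] at hg ⊢
  exact hg.continuousOn_mul (by fun_prop) isCompact_Icc

section Duhamel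

variable {v : ℝ → ℝ} {a b v₀ : ℝ}

theorem exp_mul_sub_eq_integral (hab : a ≤ b) (hv : AbsolutelyContinuousOnInterval v a b)
    (hder : ∀ᵐ t : ℝ, t ∈ Ioo a b → HasDerivAt v (g t - C * v t) t) :
    Real.exp (C * b) * v b - Real.exp (C * a) * v a = ∫ t in a..b, Real.exp (C * t) * g t := by
  have hprod := (absolutelyContinuousOnInterval_exp_mul C a b).mul hv
  have hne : ∀ᵐ t : ℝ, t ≠ b := by simp [ae_iff, measure_singleton]
  refine hprod.integral_deriv_eq_sub.symm.trans (intervalIntegral.integral_congr_ae ?_)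
  filter_upwards [hder, hne] with t ht htb htm
  rw [uIoc_of_le hab] at htm
  rw [((hasDerivAt_exp_mul C t).mul (ht ⟨htm.1, lt_of_le_of_ne htm.2 htb⟩)).deriv]
  ring

theorem tendsto_intervalIntegral_nhdsGT (hab : a < b) (hg : IntegrableOn g (Ioo a b)) :
    Tendsto (fun s => ∫ t in s..b, g t) (𝓝[>] a) (𝓝 (∫ t in a..b, g t)) := by
  rw [← integrableOn_Icc_iff_integrableOn_Ioo, ← uIcc_of_le hab.le] at hg
  have hcont := intervalIntegral.continuousOn_primitive_interval_left hg a left_mem_uIcc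
  rw [uIcc_of_le hab.le] at hcont
  refine hcont.mono_left ?_
  rw [← nhdsWithin_Ioo_eq_nhdsGT hab]
  exact nhdsWithin_mono _ Ioo_subset_Icc_self

theorem exp_mul_eq_add_integral (hab : a < b)
    (hv : ∀ s ∈ Ioo a b, AbsolutelyContinuousOnInterval v s b)
    (hder : ∀ᵐ t : ℝ, t ∈ Ioo a b → HasDerivAt v (g t - C * v t) t)
    (hg : IntegrableOn g (Ioo a b)) (hlim : Tendsto v (𝓝[>] a) (𝓝 v₀)) :
    Real.exp (C * b) * v b = Real.exp (C * a) * v₀ + ∫ t in Ioo a b, Real.exp (C * t) * g t := by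
  have hexp : Tendsto (fun s => Real.exp (C * s)) (𝓝[>] a) (𝓝 (Real.exp (C * a))) :=
    ((by fun_prop : Continuous fun s : ℝ => Real.exp (C * s)).tendsto a).mono_left
      nhdsWithin_le_nhds
  have hconst : ∀ᶠ s in 𝓝[>] a, Real.exp (C * b) * v b
      = Real.exp (C * s) * v s + ∫ t in s..b, Real.exp (C * t) * g t := by
    filter_upwards [Ioo_mem_nhdsGT hab] with s hs
    rw [← exp_mul_sub_eq_integral hs.2.le (hv s hs)
      (hder.mono fun t ht htm => ht (Ioo_subset_Ioo_left hs.1.le htm))]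
    ring
  rw [← integral_Ioc_eq_integral_Ioo, ← intervalIntegral.integral_of_le hab.le]
  exact tendsto_nhds_unique (tendsto_const_nhds.congr' hconst) ((hexp.mul hlim).add
    (tendsto_intervalIntegral_nhdsGT hab (integrableOn_exp_mul C hg)))

end Duhamel

/-- The solution `w` of `w' + C w = g` with `w c = e^{-Cc} A`. -/
def dampedSolution (C c A : ℝ) (g : ℝ → ℝ) (t : ℝ) : ℝ :=
  Real.exp (-C * t) * (A + ∫ s in c..t, Real.exp (C * s) * g s)

variable (C) (c A : ℝ)

theorem intervalIntegrable_exp_mul (hg : LocallyIntegrable g) (a b : ℝ) :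
    IntervalIntegrable (fun s => Real.exp (C * s) * g s) volume a b :=
  ((locallyIntegrable_exp_mul C hg).integrableOn_isCompact isCompact_uIcc).mono_set
    uIoc_subset_uIcc |> intervalIntegrable_iff.2

theorem continuous_dampedSolution (hg : LocallyIntegrable g) :
    Continuous (dampedSolution C c A g) := by
  have := intervalIntegral.continuous_primitive (intervalIntegrable_exp_mul C hg) c
  unfold dampedSolution
  fun_prop

theorem absolutelyContinuousOnInterval_dampedSolution (hg : LocallyIntegrable g) (a b : ℝ) :
    AbsolutelyContinuousOnInterval (dampedSolution C c A g) a b := by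
  have hii := intervalIntegrable_exp_mul C hg
  have hconst : AbsolutelyContinuousOnInterval
      (fun _ : ℝ => A + ∫ s in c..a, Real.exp (C * s) * g s) a b :=
    ContDiffOn.absolutelyContinuousOnInterval contDiffOn_const
  have hprim := (hii a b).absolutelyContinuousOnInterval_intervalIntegral (c := a) left_mem_uIcc
  refine absolutelyContinuousOnInterval_congr
    ((absolutelyContinuousOnInterval_exp_mul (-C) a b).mul (hconst.add hprim)) fun t _ => ?_
  simp only [dampedSolution, Pi.mul_apply, Pi.add_apply, add_assoc,
    intervalIntegral.integral_add_adjacent_intervals (hii c a) (hii a t)]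

theorem ae_hasDerivAt_dampedSolution (hg : LocallyIntegrable g) :
    ∀ᵐ t, HasDerivAt (dampedSolution C c A g) (g t - C * dampedSolution C c A g t) t := by
  filter_upwards [LocallyIntegrable.ae_hasDerivAt_integral (locallyIntegrable_exp_mul C hg)]
    with t ht
  refine ((hasDerivAt_exp_mul (-C) t).mul ((ht c).const_add A)).congr_deriv ?_
  have hexp : Real.exp (-C * t) * Real.exp (C * t) = 1 := by rw [← Real.exp_add]; simp
  rw [dampedSolution]
  linear_combination g t * hexp

end DampedEquation

section Attenuation

/-- The field in `Ω` produced by the boundary source `qb` under the constant attenuation `C`. -/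
def attenuatedInflow (C : ℝ) (Ω : Set (Space d)) (qb : Space d × Dir d → ℝ)
    (z : Space d × Dir d) : ℝ :=
  Real.exp (-(C * backTime Ω z)) * inflowExt Ω qb z

/-- The field in `Ω` produced by the real-valued source `G` under the constant attenuation `C`,
without inflow; `streamed` is its counterpart for sources with values in `[0, ∞]`. -/
def attenuatedSource (C : ℝ) (Ω : Set (Space d)) (G : Space d × Dir d → ℝ)
    (z : Space d × Dir d) : ℝ :=
  ∫ t in Ioo (-backTime Ω z) 0, Real.exp (C * t) * G (flow z t)

theorem ofReal_integral_le_lintegral {α : Type*} [MeasurableSpace α] {m : Measure α}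
    (F : α → ℝ) : ENNReal.ofReal (∫ x, F x ∂m) ≤ ∫⁻ x, ENNReal.ofReal (F x) ∂m := by
  by_cases hF : Integrable F m
  · rw [integral_eq_lintegral_pos_part_sub_lintegral_neg_part hF]
    exact (ENNReal.ofReal_le_ofReal (sub_le_self _ ENNReal.toReal_nonneg)).trans
      ENNReal.ofReal_toReal_le
  · simp [integral_undef hF]

namespace IsConvexDomain

variable {Ω : Set (Space d)} {C : ℝ} {G H qb : Space d × Dir d → ℝ}

theorem memLp_attenuatedInflow (hΩ : IsConvexDomain Ω) (hC : 0 ≤ C) {p : ℝ≥0∞}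
    (hqb : MemLp (inflowExt Ω qb) p (phaseMeasure Ω)) :
    MemLp (attenuatedInflow C Ω qb) p (phaseMeasure Ω) := by
  refine hqb.of_le (AEStronglyMeasurable.mul ?_ hqb.1) ?_
  · exact Real.continuous_exp.comp_aestronglyMeasurable
      (hΩ.aestronglyMeasurable_backTime.const_mul C).neg
  · filter_upwards [ae_phaseMeasure_mem hΩ.isOpen.measurableSet] with z hz
    rw [attenuatedInflow, norm_mul, Real.norm_of_nonneg (Real.exp_pos _).le]
    exact mul_le_of_le_one_left (norm_nonneg _)
      (Real.exp_le_one_iff.2 (neg_nonpos.2 (mul_nonneg hC (hΩ.backTime_pos hz).le)))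

theorem attenuatedSource_congr (hΩ : IsConvexDomain Ω) (h : G =ᵐ[phaseMeasure Ω] H) :
    attenuatedSource C Ω G =ᵐ[phaseMeasure Ω] attenuatedSource C Ω H := by
  filter_upwards [hΩ.ae_restrict_Ioo_flow_of_ae h] with z hz
  refine integral_congr_ae ?_
  filter_upwards [hz] with t ht
  rw [ht]

theorem attenuatedSource_sub (hΩ : IsConvexDomain Ω) (hG : Integrable G (phaseMeasure Ω))
    (hH : Integrable H (phaseMeasure Ω)) :
    attenuatedSource C Ω (fun z => G z - H z)
      =ᵐ[phaseMeasure Ω] fun z => attenuatedSource C Ω G z - attenuatedSource C Ω H z := by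
  filter_upwards [hΩ.ae_integrableOn_flow hG, hΩ.ae_integrableOn_flow hH] with z hGz hHz
  simp only [attenuatedSource, mul_sub]
  exact integral_sub (integrableOn_exp_mul C hGz) (integrableOn_exp_mul C hHz)

theorem attenuatedSource_nonneg (hΩ : IsConvexDomain Ω) (hG : ∀ᵐ z ∂(phaseMeasure Ω), 0 ≤ G z) :
    ∀ᵐ z ∂(phaseMeasure Ω), 0 ≤ attenuatedSource C Ω G z := by
  filter_upwards [hΩ.ae_restrict_Ioo_flow_of_ae hG] with z hz
  exact integral_nonneg_of_ae (hz.mono fun t ht => mul_nonneg (Real.exp_pos _).le ht)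

theorem attenuatedSource_pos (hΩ : IsConvexDomain Ω) (hGi : Integrable G (phaseMeasure Ω))
    (hG : ∀ᵐ z ∂(phaseMeasure Ω), 0 < G z) :
    ∀ᵐ z ∂(phaseMeasure Ω), 0 < attenuatedSource C Ω G z := by
  filter_upwards [ae_phaseMeasure_mem hΩ.isOpen.measurableSet, hΩ.ae_integrableOn_flow hGi,
    hΩ.ae_restrict_Ioo_flow_of_ae hG] with z hz hint hpos
  have hpos' : ∀ᵐ t ∂(volume.restrict (Ioo (-backTime Ω z) 0)),
      0 < Real.exp (C * t) * G (flow z t) :=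
    hpos.mono fun t ht => mul_pos (Real.exp_pos _) ht
  have hsupp : Function.support (fun t => Real.exp (C * t) * G (flow z t))
      =ᵐ[volume.restrict (Ioo (-backTime Ω z) 0)] univ :=
    eventuallyEq_univ.2 (hpos'.mono fun t ht => ht.ne')
  rw [attenuatedSource, integral_pos_iff_support_of_nonneg_ae (hpos'.mono fun t ht => ht.le)
    (integrableOn_exp_mul C hint), measure_congr hsupp, Measure.restrict_apply_univ,
    Real.volume_Ioo]
  simpa using hΩ.backTime_pos hz

theorem attenuatedSource_toReal (hΩ : IsConvexDomain Ω) {g : Space d × Dir d → ℝ≥0∞}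
    (hg : Measurable g) (hfin : ∀ᵐ z ∂(phaseMeasure Ω), g z < ∞) :
    attenuatedSource C Ω (fun z => (g z).toReal)
      =ᵐ[phaseMeasure Ω] fun z => (streamed C Ω g z).toReal := by
  filter_upwards [ae_phaseMeasure_mem hΩ.isOpen.measurableSet,
    hΩ.ae_restrict_Ioo_flow_of_ae hfin] with z hz hfinz
  have hmeas : Measurable fun t => ENNReal.ofReal (Real.exp (C * t)) * g (flow z t) :=
    Measurable.mul (by fun_prop) (hg.comp (measurable_flow_right z))
  rw [hΩ.streamed_eq_setLIntegral C hg hz, ← integral_toReal hmeas.aemeasurable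
    (hfinz.mono fun t ht => ENNReal.mul_lt_top ENNReal.ofReal_lt_top ht)]
  simp only [attenuatedSource, ENNReal.toReal_mul, ENNReal.toReal_ofReal (Real.exp_pos _).le]

theorem ofReal_neg_attenuatedSource_le (hΩ : IsConvexDomain Ω) {g : Space d × Dir d → ℝ≥0∞}
    (hg : Measurable g) (hGg : ∀ᵐ z ∂(phaseMeasure Ω), ENNReal.ofReal (-G z) ≤ g z) :
    ∀ᵐ z ∂(phaseMeasure Ω), ENNReal.ofReal (-attenuatedSource C Ω G z) ≤ streamed C Ω g z := by
  filter_upwards [ae_phaseMeasure_mem hΩ.isOpen.measurableSet,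
    hΩ.ae_restrict_Ioo_flow_of_ae hGg] with z hz hle
  rw [hΩ.streamed_eq_setLIntegral C hg hz, attenuatedSource, ← integral_neg]
  refine (ofReal_integral_le_lintegral _).trans (lintegral_mono_ae (hle.mono fun t ht => ?_))
  rw [← mul_neg, ENNReal.ofReal_mul (Real.exp_pos _).le]
  gcongr

theorem attenuatedSource_flow (hΩ : IsConvexDomain Ω) {z : Space d × Dir d} {t : ℝ}
    (hz : z.1 ∈ Ω) (ht : (flow z t).1 ∈ Ω) :
    attenuatedSource C Ω G (flow z t) = Real.exp (-C * t)
      * ∫ s in (-backTime Ω z)..t, Real.exp (C * s) * (Prod.fst ⁻¹' Ω).indicator G (flow z s) := by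
  have hind : ∀ s ∈ Ioo (-(backTime Ω z + t)) 0,
      G (flow z (t + s)) = (Prod.fst ⁻¹' Ω).indicator G (flow z (t + s)) := fun s hs =>
    (indicator_of_mem (s := Prod.fst ⁻¹' Ω)
      ((hΩ.flow_mem_iff_of_le hz ht (by linarith [hs.2])).2 (by linarith [hs.1])) G).symm
  have hexp : ∀ s, Real.exp (C * s) = Real.exp (-C * t) * Real.exp (C * (t + s)) := fun s => by
    rw [← Real.exp_add]
    ring_nf
  have hshift := intervalIntegral.integral_comp_add_left (a := -(backTime Ω z + t)) (b := 0)
    (fun s => Real.exp (-C * t)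
      * (Real.exp (C * s) * (Prod.fst ⁻¹' Ω).indicator G (flow z s))) t
  calc attenuatedSource C Ω G (flow z t)
      = ∫ s in Ioo (-(backTime Ω z + t)) 0, Real.exp (-C * t)
          * (Real.exp (C * (t + s)) * (Prod.fst ⁻¹' Ω).indicator G (flow z (t + s))) := by
        rw [attenuatedSource, hΩ.backTime_flow hz ht]
        refine setIntegral_congr_fun measurableSet_Ioo fun s hs => ?_
        simp only [flow_flow, hind s hs, hexp s, mul_assoc]
    _ = ∫ s in (-backTime Ω z)..t, Real.exp (-C * t)
          * (Real.exp (C * s) * (Prod.fst ⁻¹' Ω).indicator G (flow z s)) := by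
        rw [← integral_Ioc_eq_integral_Ioo, ← intervalIntegral.integral_of_le
          (by linarith [hΩ.neg_backTime_lt hz ht]), hshift]
        ring_nf
    _ = _ := intervalIntegral.integral_const_mul _ _

theorem attenuatedInflow_flow (hΩ : IsConvexDomain Ω) {z : Space d × Dir d} {t : ℝ}
    (hz : z.1 ∈ Ω) (ht : (flow z t).1 ∈ Ω) :
    attenuatedInflow C Ω qb (flow z t) = Real.exp (-C * t) * attenuatedInflow C Ω qb z := by
  rw [attenuatedInflow, attenuatedInflow, hΩ.backTime_flow hz ht, hΩ.inflowExt_flow qb hz ht,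
    ← mul_assoc, ← Real.exp_add]
  ring_nf

theorem attenuatedInflow_add_attenuatedSource_flow (hΩ : IsConvexDomain Ω)
    {z : Space d × Dir d} {t : ℝ} (hz : z.1 ∈ Ω) (ht : (flow z t).1 ∈ Ω) :
    attenuatedInflow C Ω qb (flow z t) + attenuatedSource C Ω G (flow z t)
      = dampedSolution C (-backTime Ω z) (attenuatedInflow C Ω qb z)
        (fun s => (Prod.fst ⁻¹' Ω).indicator G (flow z s)) t := by
  rw [hΩ.attenuatedInflow_flow hz ht, hΩ.attenuatedSource_flow hz ht, dampedSolution, mul_add]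

end IsConvexDomain

end Attenuation

section Scattering

variable {Ω : Set (Space d)} {f : Dir d → Dir d → ℝ}

/-- The kernel `(x, θ) ↦ f(θ, θ') dθ'` on the fibre over `x`; it represents `scatter f`. -/
def scatterKernel (f : Dir d → Dir d → ℝ) : Kernel (Space d × Dir d) (Space d × Dir d) :=
  Kernel.deterministic Prod.fst measurable_fst ×ₖ
    (Kernel.const _ (angularMeasure d)).withDensity fun z θ' => ((f z.2 θ').toNNReal : ℝ≥0∞)

instance (f : Dir d → Dir d → ℝ) : IsSFiniteKernel (scatterKernel f) := by
  unfold scatterKernel; infer_instance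

theorem withDensity_comp_measure {α β : Type*} [MeasurableSpace α] [MeasurableSpace β]
    (κ : Kernel α β) [IsSFiniteKernel κ] (m : Measure α) {w : β → ℝ≥0∞} (hw : Measurable w) :
    κ.withDensity (fun _ => w) ∘ₘ m = (κ ∘ₘ m).withDensity w := by
  have hw' : Measurable (Function.uncurry fun (_ : α) => w) := hw.comp measurable_snd
  ext s hs
  rw [Measure.bind_apply hs (Kernel.aemeasurable _), withDensity_apply _ hs,
    ← lintegral_indicator hs, Measure.lintegral_bind (Kernel.aemeasurable _)
      (hw.indicator hs).aemeasurable]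
  refine lintegral_congr fun a => ?_
  rw [Kernel.withDensity_apply _ hw', withDensity_apply _ hs, lintegral_indicator hs]

namespace IsScatteringKernel

theorem measurable_toNNReal (hf : IsScatteringKernel f) :
    Measurable (Function.uncurry fun (z : Space d × Dir d) θ' => ((f z.2 θ').toNNReal : ℝ≥0∞)) :=
  (hf.measurable.comp
    ((measurable_snd.comp measurable_fst).prodMk measurable_snd)).real_toNNReal.coe_nnreal_ennreal

theorem lintegral_eq_one (hf : IsScatteringKernel f) (θ : Dir d) :
    ∫⁻ θ', ENNReal.ofReal (f θ θ') ∂(angularMeasure d) = 1 := by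
  rw [← ofReal_integral_eq_lintegral_ofReal _ (ae_of_all _ (hf.nonneg θ)), hf.integral_eq_one,
    ENNReal.ofReal_one]
  exact .of_integral_ne_zero (by simp [hf.integral_eq_one])

theorem measurable_ofReal (hf : IsScatteringKernel f) (θ : Dir d) :
    Measurable fun θ' => ENNReal.ofReal (f θ θ') :=
  (hf.measurable.comp measurable_prodMk_left).ennreal_ofReal

theorem scatterKernel_apply (hf : IsScatteringKernel f) (z : Space d × Dir d) :
    scatterKernel f z = ((angularMeasure d).withDensity fun θ' => ENNReal.ofReal (f z.2 θ')).map
      (Prod.mk z.1) := by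
  rw [scatterKernel, Kernel.prod_apply, Kernel.deterministic_apply,
    Kernel.withDensity_apply _ hf.measurable_toNNReal, Kernel.const_apply, Measure.dirac_prod]
  rfl

theorem ae_scatterKernel_fst_eq (hf : IsScatteringKernel f) (z : Space d × Dir d) :
    ∀ᵐ y ∂(scatterKernel f z), y.1 = z.1 := by
  rw [hf.scatterKernel_apply, (measurableEmbedding_prodMk_left z.1).ae_map_iff]
  exact ae_of_all _ fun _ => rfl

theorem lintegral_scatterKernel (hf : IsScatteringKernel f) {g : Space d × Dir d → ℝ≥0∞}
    (hg : Measurable g) (z : Space d × Dir d) :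
    ∫⁻ y, g y ∂(scatterKernel f z)
      = ∫⁻ θ', ENNReal.ofReal (f z.2 θ') * g (z.1, θ') ∂(angularMeasure d) := by
  rw [hf.scatterKernel_apply, lintegral_map hg measurable_prodMk_left]
  exact lintegral_withDensity_eq_lintegral_mul _ (hf.measurable_ofReal z.2)
    (hg.comp measurable_prodMk_left)

theorem scatterKernel_univ (hf : IsScatteringKernel f) (z : Space d × Dir d) :
    scatterKernel f z univ = 1 := by
  simpa [hf.lintegral_eq_one] using hf.lintegral_scatterKernel (g := 1) measurable_one z

theorem integral_scatterKernel (hf : IsScatteringKernel f) (φ : Space d × Dir d → ℝ)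
    (z : Space d × Dir d) : ∫ y, φ y ∂(scatterKernel f z) = scatter f φ z := by
  rw [hf.scatterKernel_apply, (measurableEmbedding_prodMk_left z.1).integral_map,
    integral_withDensity_eq_integral_toReal_smul (hf.measurable_ofReal z.2)
      (ae_of_all _ fun _ => ENNReal.ofReal_lt_top)]
  simp only [ENNReal.toReal_ofReal (hf.nonneg _ _), smul_eq_mul, scatter]

theorem scatterKernel_comp_phaseMeasure (hf : IsScatteringKernel f) (Ω : Set (Space d)) :
    scatterKernel f ∘ₘ phaseMeasure Ω = phaseMeasure Ω := by
  ext s hs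
  have hind : Measurable (s.indicator (1 : Space d × Dir d → ℝ≥0∞)) := measurable_one.indicator hs
  have hind' (x : Space d) : Measurable fun θ' : Dir d => s.indicator 1 (x, θ') :=
    hind.comp measurable_prodMk_left
  have hf' : Measurable (Function.uncurry fun θ θ' => ENNReal.ofReal (f θ θ')) :=
    hf.measurable.ennreal_ofReal
  have hswap (x : Space d) :
      ∫⁻ θ, ∫⁻ θ', ENNReal.ofReal (f θ θ') * s.indicator 1 (x, θ') ∂(angularMeasure d)
        ∂(angularMeasure d) = ∫⁻ θ', s.indicator 1 (x, θ') ∂(angularMeasure d) := by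
    rw [lintegral_lintegral_swap (hf'.mul ((hind' x).comp measurable_snd)).aemeasurable]
    refine lintegral_congr fun θ' => ?_
    simp only [fun θ => hf.symm θ θ']
    rw [lintegral_mul_const _ (hf.measurable_ofReal θ'), hf.lintegral_eq_one, one_mul]
  rw [← lintegral_indicator_one hs, ← lintegral_indicator_one hs,
    Measure.lintegral_bind (Kernel.aemeasurable _) hind.aemeasurable, phaseMeasure,
    lintegral_prod _ hind.lintegral_kernel.aemeasurable, lintegral_prod _ hind.aemeasurable]
  refine lintegral_congr fun x => ?_
  simp only [hf.lintegral_scatterKernel hind, hswap]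

theorem scatter_congr (hf : IsScatteringKernel f) {φ ψ : Space d × Dir d → ℝ}
    (h : φ =ᵐ[phaseMeasure Ω] ψ) : scatter f φ =ᵐ[phaseMeasure Ω] scatter f ψ := by
  rw [← hf.scatterKernel_comp_phaseMeasure] at h
  filter_upwards [Measure.ae_ae_of_ae_comp h] with z hz
  rw [← hf.integral_scatterKernel, ← hf.integral_scatterKernel, integral_congr_ae hz]

end IsScatteringKernel

end Scattering

section Collision

variable {Ω : Set (Space d)} {f : Dir d → Dir d → ℝ} {a C : ℝ} {μa μs : Space d → ℝ}

/-- The part `(C - μa - μs) φ + μs K φ` of the transport equation that remains when the constant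
attenuation `C` is moved to the left-hand side. -/
def collision (f : Dir d → Dir d → ℝ) (μa μs : Space d → ℝ) (C : ℝ) (φ : Space d × Dir d → ℝ)
    (z : Space d × Dir d) : ℝ :=
  (C - μa z.1 - μs z.1) * φ z + μs z.1 * scatter f φ z

/-- Coefficients in the subcritical regime: the absorption `μa` is at least `a > 0`, the
scattering coefficient `μs` is nonnegative, and the total attenuation `μa + μs` is at
most `C`. -/
structure IsSubcritical (Ω : Set (Space d)) (a C : ℝ) (μa μs : Space d → ℝ) : Prop where
  pos : 0 < a
  le : a ≤ C
  aestronglyMeasurable_absorption : AEStronglyMeasurable μa (volume.restrict Ω)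
  aestronglyMeasurable_scattering : AEStronglyMeasurable μs (volume.restrict Ω)
  bounds : ∀ᵐ x ∂(volume.restrict Ω), a ≤ μa x ∧ 0 ≤ μs x ∧ μa x + μs x ≤ C

/-- `κ` represents the collision operator on integrable functions, and its mass in either variable
is at most `C - a`: this turns subcriticality into a contraction estimate. -/
structure IsCollisionKernel (Ω : Set (Space d)) (f : Dir d → Dir d → ℝ) (a C : ℝ)
    (μa μs : Space d → ℝ) (κ : Kernel (Space d × Dir d) (Space d × Dir d)) : Prop where
  univ_le : ∀ᵐ z ∂(phaseMeasure Ω), κ z univ ≤ ENNReal.ofReal (C - a)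
  comp_le : κ ∘ₘ phaseMeasure Ω ≤ ENNReal.ofReal (C - a) • phaseMeasure Ω
  collision_eq : ∀ φ, Integrable φ (phaseMeasure Ω) →
    collision f μa μs C φ =ᵐ[phaseMeasure Ω] fun z => ∫ y, φ y ∂(κ z)

theorem IsScatteringKernel.ae_integrable_scatterKernel (hf : IsScatteringKernel f)
    {φ : Space d × Dir d → ℝ} (hφ : Integrable φ (phaseMeasure Ω)) :
    ∀ᵐ z ∂(phaseMeasure Ω), Integrable φ (scatterKernel f z) :=
  Measure.ae_integrable_of_integrable_comp ((hf.scatterKernel_comp_phaseMeasure Ω).symm ▸ hφ)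

/-- The kernel representing the collision operator with measurable coefficients. -/
def collisionKernel (f : Dir d → Dir d → ℝ) (μa μs : Space d → ℝ) (C : ℝ) :
    Kernel (Space d × Dir d) (Space d × Dir d) :=
  Kernel.id.withDensity (fun _ y => ((C - μa y.1 - μs y.1).toNNReal : ℝ≥0∞))
    + (scatterKernel f).withDensity (fun _ y => ((μs y.1).toNNReal : ℝ≥0∞))

theorem collisionKernel_apply (hf : IsScatteringKernel f) (hμa : Measurable μa)
    (hμs : Measurable μs) (z : Space d × Dir d) :
    collisionKernel f μa μs C z = ENNReal.ofReal (C - μa z.1 - μs z.1) • Measure.dirac z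
      + ENNReal.ofReal (μs z.1) • scatterKernel f z := by
  have hfst : (fun y => ENNReal.ofReal (μs y.1)) =ᵐ[scatterKernel f z]
      fun _ => ENNReal.ofReal (μs z.1) := by
    filter_upwards [hf.ae_scatterKernel_fst_eq z] with y hy
    rw [hy]
  rw [collisionKernel, FunLike.coe_add, Pi.add_apply, Kernel.withDensity_apply _ (by fun_prop),
    Kernel.withDensity_apply _ (by fun_prop), Kernel.id_apply]
  exact congrArg₂ _ (dirac_withDensity _ _)
    ((withDensity_congr_ae hfst).trans (withDensity_const _))

theorem collisionKernel_univ (hf : IsScatteringKernel f) (hμa : Measurable μa)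
    (hμs : Measurable μs) (z : Space d × Dir d) :
    collisionKernel f μa μs C z univ
      = ENNReal.ofReal (C - μa z.1 - μs z.1) + ENNReal.ofReal (μs z.1) := by
  simp [collisionKernel_apply hf hμa hμs, hf.scatterKernel_univ]

theorem integral_collisionKernel (hf : IsScatteringKernel f) (hμa : Measurable μa)
    (hμs : Measurable μs) {φ : Space d × Dir d → ℝ} {z : Space d × Dir d}
    (hφ : Integrable φ (scatterKernel f z)) (hz : 0 ≤ μs z.1 ∧ μa z.1 + μs z.1 ≤ C) :
    ∫ y, φ y ∂(collisionKernel f μa μs C z) = collision f μa μs C φ z := by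
  rw [collisionKernel_apply hf hμa hμs, integral_add_measure, integral_smul_measure,
    integral_smul_measure, integral_dirac, hf.integral_scatterKernel,
    ENNReal.toReal_ofReal (by linarith), ENNReal.toReal_ofReal hz.1]
  · rfl
  · exact (integrable_dirac ENNReal.coe_lt_top).smul_measure ENNReal.ofReal_ne_top
  · exact hφ.smul_measure ENNReal.ofReal_ne_top

theorem collisionKernel_comp_phaseMeasure (hf : IsScatteringKernel f) (hμa : Measurable μa)
    (hμs : Measurable μs) :
    collisionKernel f μa μs C ∘ₘ phaseMeasure Ω = (phaseMeasure Ω).withDensity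
      fun z => ENNReal.ofReal (C - μa z.1 - μs z.1) + ENNReal.ofReal (μs z.1) := by
  have hα : Measurable fun z : Space d × Dir d => ENNReal.ofReal (C - μa z.1 - μs z.1) := by
    fun_prop
  have hβ : Measurable fun z : Space d × Dir d => ENNReal.ofReal (μs z.1) := by fun_prop
  rw [collisionKernel, Measure.add_comp]
  refine (congrArg₂ _ (withDensity_comp_measure _ _ hα) (withDensity_comp_measure _ _ hβ)).trans ?_
  rw [Measure.id_comp, hf.scatterKernel_comp_phaseMeasure, ← withDensity_add_left hα]
  rfl

theorem IsSubcritical.exists_isCollisionKernel (h : IsSubcritical Ω a C μa μs)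
    (hf : IsScatteringKernel f) : ∃ κ, IsCollisionKernel Ω f a C μa μs κ := by
  obtain ⟨μa', hμa, hμaa'⟩ := h.aestronglyMeasurable_absorption
  obtain ⟨μs', hμs, hμss'⟩ := h.aestronglyMeasurable_scattering
  have hcoeff : ∀ᵐ z ∂(phaseMeasure Ω), (a ≤ μa' z.1 ∧ 0 ≤ μs' z.1 ∧ μa' z.1 + μs' z.1 ≤ C)
      ∧ μa z.1 = μa' z.1 ∧ μs z.1 = μs' z.1 := by
    filter_upwards [ae_phaseMeasure_of_ae h.bounds, ae_phaseMeasure_of_ae hμaa',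
      ae_phaseMeasure_of_ae hμss'] with z hz hza hzs
    exact ⟨by rwa [← hza, ← hzs], hza, hzs⟩
  have hmass : ∀ᵐ z ∂(phaseMeasure Ω),
      ENNReal.ofReal (C - μa' z.1 - μs' z.1) + ENNReal.ofReal (μs' z.1)
        ≤ ENNReal.ofReal (C - a) := by
    filter_upwards [hcoeff] with z ⟨hz, _⟩
    rw [← ENNReal.ofReal_add (by linarith [hz.2.2]) hz.2.1]
    exact ENNReal.ofReal_le_ofReal (by linarith [hz.1])
  refine ⟨collisionKernel f μa' μs' C, ?_, ?_, fun φ hφ => ?_⟩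
  · simpa only [collisionKernel_univ hf hμa.measurable hμs.measurable] using hmass
  · rw [collisionKernel_comp_phaseMeasure hf hμa.measurable hμs.measurable, ← withDensity_const]
    exact withDensity_mono hmass
  · filter_upwards [hf.ae_integrable_scatterKernel hφ, hcoeff] with z hφz ⟨hz, hza, hzs⟩
    rw [integral_collisionKernel hf hμa.measurable hμs.measurable hφz hz.2, collision, collision,
      hza, hzs]

namespace IsCollisionKernel

variable {κ : Kernel (Space d × Dir d) (Space d × Dir d)} {φ ψ : Space d × Dir d → ℝ}

theorem eLpNorm_lintegral_le (hκ : IsCollisionKernel Ω f a C μa μs κ) {p : ℝ≥0∞} (hp : 1 ≤ p)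
    {g : Space d × Dir d → ℝ≥0∞} (hg : Measurable g) :
    eLpNorm (fun z => ∫⁻ y, g y ∂(κ z)) p (phaseMeasure Ω)
      ≤ ENNReal.ofReal (C - a) * eLpNorm g p (phaseMeasure Ω) :=
  eLpNorm_lintegral_kernel_le hκ.univ_le hκ.comp_le hp hg

theorem integrable_comp (hκ : IsCollisionKernel Ω f a C μa μs κ)
    (hφ : Integrable φ (phaseMeasure Ω)) : Integrable φ (κ ∘ₘ phaseMeasure Ω) :=
  (hφ.smul_measure ENNReal.ofReal_ne_top).mono_measure hκ.comp_le

theorem ae_integrable (hκ : IsCollisionKernel Ω f a C μa μs κ)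
    (hφ : Integrable φ (phaseMeasure Ω)) : ∀ᵐ z ∂(phaseMeasure Ω), Integrable φ (κ z) :=
  Measure.ae_integrable_of_integrable_comp (hκ.integrable_comp hφ)

theorem ae_ae_of_ae (hκ : IsCollisionKernel Ω f a C μa μs κ) {P : Space d × Dir d → Prop}
    (h : ∀ᵐ z ∂(phaseMeasure Ω), P z) : ∀ᵐ z ∂(phaseMeasure Ω), ∀ᵐ y ∂(κ z), P y :=
  Measure.ae_ae_of_ae_comp
    (((Measure.absolutelyContinuous_of_le hκ.comp_le).trans
      (Measure.smul_absolutelyContinuous)).ae_le h)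

theorem integrable_collision (hκ : IsCollisionKernel Ω f a C μa μs κ)
    (hφ : Integrable φ (phaseMeasure Ω)) :
    Integrable (collision f μa μs C φ) (phaseMeasure Ω) := by
  have hcomp := hκ.integrable_comp hφ
  rw [Measure.comp_eq_comp_const_apply] at hcomp
  refine Integrable.congr ?_ (hκ.collision_eq φ hφ).symm
  simpa using hcomp.integral_comp

theorem collision_congr (hκ : IsCollisionKernel Ω f a C μa μs κ)
    (hφ : Integrable φ (phaseMeasure Ω)) (h : φ =ᵐ[phaseMeasure Ω] ψ) :
    collision f μa μs C φ =ᵐ[phaseMeasure Ω] collision f μa μs C ψ := by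
  filter_upwards [hκ.collision_eq φ hφ, hκ.collision_eq ψ (hφ.congr h), hκ.ae_ae_of_ae h]
    with z hφz hψz hz
  rw [hφz, hψz, integral_congr_ae hz]

theorem collision_sub (hκ : IsCollisionKernel Ω f a C μa μs κ)
    (hφ : Integrable φ (phaseMeasure Ω)) (hψ : Integrable ψ (phaseMeasure Ω)) :
    ∀ᵐ z ∂(phaseMeasure Ω), collision f μa μs C (fun y => φ y - ψ y) z
      = collision f μa μs C φ z - collision f μa μs C ψ z := by
  filter_upwards [hκ.collision_eq _ (hφ.sub hψ), hκ.collision_eq φ hφ, hκ.collision_eq ψ hψ,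
    hκ.ae_integrable hφ, hκ.ae_integrable hψ] with z hsub hφz hψz hφi hψi
  rw [hφz, hψz, ← integral_sub hφi hψi]
  exact hsub

theorem collision_nonneg (hκ : IsCollisionKernel Ω f a C μa μs κ)
    (hφ : Integrable φ (phaseMeasure Ω)) (h : ∀ᵐ z ∂(phaseMeasure Ω), 0 ≤ φ z) :
    ∀ᵐ z ∂(phaseMeasure Ω), 0 ≤ collision f μa μs C φ z := by
  filter_upwards [hκ.collision_eq φ hφ, hκ.ae_ae_of_ae h] with z hz hnonneg
  exact hz ▸ integral_nonneg_of_ae hnonneg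

theorem ofReal_neg_collision_le (hκ : IsCollisionKernel Ω f a C μa μs κ)
    (hφ : Integrable φ (phaseMeasure Ω)) {g : Space d × Dir d → ℝ≥0∞}
    (hg : ∀ᵐ z ∂(phaseMeasure Ω), ENNReal.ofReal (-φ z) ≤ g z) :
    ∀ᵐ z ∂(phaseMeasure Ω),
      ENNReal.ofReal (-collision f μa μs C φ z) ≤ ∫⁻ y, g y ∂(κ z) := by
  filter_upwards [hκ.collision_eq φ hφ, hκ.ae_ae_of_ae hg] with z hz hle
  rw [hz, ← integral_neg]
  exact (ofReal_integral_le_lintegral _).trans (lintegral_mono_ae hle)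

theorem collision_toReal (hκ : IsCollisionKernel Ω f a C μa μs κ)
    {g : Space d × Dir d → ℝ≥0∞} (hg : Measurable g)
    (hgi : Integrable (fun z => (g z).toReal) (phaseMeasure Ω))
    (hfin : ∀ᵐ z ∂(phaseMeasure Ω), g z < ∞) :
    collision f μa μs C (fun z => (g z).toReal)
      =ᵐ[phaseMeasure Ω] fun z => (∫⁻ y, g y ∂(κ z)).toReal := by
  filter_upwards [hκ.collision_eq _ hgi, hκ.ae_ae_of_ae hfin] with z hz hfinz
  rw [hz, integral_toReal hg.aemeasurable hfinz]

end IsCollisionKernel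

end Collision

section MildSolution

variable {Ω : Set (Space d)} {f : Dir d → Dir d → ℝ} {p : ℝ≥0∞} {a C : ℝ}
  {μa μa₁ μa₂ μs : Space d → ℝ} {q q₁ q₂ qb J φ φ₁ φ₂ : Space d × Dir d → ℝ}
  {κ κ₁ κ₂ : Kernel (Space d × Dir d) (Space d × Dir d)}

/-- The integrated form of the transport equation with source `q` and free field `J`: the
collisions are treated as a source and the constant attenuation `C` is inverted along the lines of
flight. For a solution with inflow `qb` the free field is `attenuatedInflow C Ω qb`. -/
structure IsMildSolution (Ω : Set (Space d)) (f : Dir d → Dir d → ℝ) (C : ℝ)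
    (μa μs : Space d → ℝ) (q J φ : Space d × Dir d → ℝ) : Prop where
  integrable_source : Integrable q (phaseMeasure Ω)
  integrable : Integrable φ (phaseMeasure Ω)
  ae_eq : φ =ᵐ[phaseMeasure Ω]
    fun z => J z + attenuatedSource C Ω (fun y => q y + collision f μa μs C φ y) z

theorem IsRTESolution.isMildSolution (h : IsRTESolution Ω f p μa μs q qb φ)
    (hΩ : IsConvexDomain Ω) (hκ : IsCollisionKernel Ω f a C μa μs κ) (hp : 1 ≤ p)
    (hq : Integrable q (phaseMeasure Ω)) :
    IsMildSolution Ω f C μa μs q (attenuatedInflow C Ω qb) φ := by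
  have : IsFiniteMeasure (phaseMeasure Ω) := isFiniteMeasure_phaseMeasure hΩ.isBounded
  have hφ : Integrable φ (phaseMeasure Ω) := h.memLp.integrable hp
  obtain ⟨u, huφ, hu⟩ := h.exists_rep
  have hrep : ∀ᵐ z ∂(phaseMeasure Ω),
      u z = φ z ∧ collision f μa μs C φ z = collision f μa μs C u z :=
    huφ.and (hκ.collision_congr hφ huφ.symm)
  refine ⟨hq, hφ, ?_⟩
  filter_upwards [ae_phaseMeasure_mem hΩ.isOpen.measurableSet, huφ, hu,
    ae_ae_flow_of_ae hΩ.isOpen.measurableSet hrep,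
    hΩ.ae_integrableOn_flow (hq.add (hκ.integrable_collision hφ))]
    with z hz hzu ⟨hac, hder, hlim⟩ hline hint
  have hmem : ∀ t ∈ Ioc (-backTime Ω z) 0, (flow z t).1 ∈ Ω := fun t ht =>
    hΩ.flow_mem_of_mem_Ioc hz ht
  have hder' : ∀ᵐ t, t ∈ Ioo (-backTime Ω z) 0 → HasDerivAt (fun s => u (flow z s))
      (q (flow z t) + collision f μa μs C φ (flow z t) - C * u (flow z t)) t := by
    filter_upwards [hder, hline] with t htder hteq ht
    have htΩ := hmem t ⟨ht.1, ht.2.le⟩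
    refine (htder htΩ).congr_deriv ?_
    rw [(hteq htΩ).2, collision]
    ring
  have hduhamel := exp_mul_eq_add_integral (neg_lt_zero.2 (hΩ.backTime_pos hz))
    (fun s hs => hac s 0 hs.2.le fun t ht => hmem t ⟨hs.1.trans_le ht.1, ht.2⟩) hder' hint hlim
  simpa only [mul_zero, Real.exp_zero, one_mul, flow_zero, hzu, mul_neg, attenuatedInflow,
    attenuatedSource] using hduhamel

namespace IsMildSolution

theorem integrable_add_collision (h : IsMildSolution Ω f C μa μs q J φ)
    (hκ : IsCollisionKernel Ω f a C μa μs κ) :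
    Integrable (fun z => q z + collision f μa μs C φ z) (phaseMeasure Ω) :=
  h.integrable_source.add (hκ.integrable_collision h.integrable)

theorem isRTESolution (h : IsMildSolution Ω f C μa μs q (attenuatedInflow C Ω qb) φ)
    (hΩ : IsConvexDomain Ω) (hκ : IsCollisionKernel Ω f a C μa μs κ)
    (hφ : MemLp φ p (phaseMeasure Ω)) : IsRTESolution Ω f p μa μs q qb φ := by
  set G := fun z => q z + collision f μa μs C φ z
  set u := fun z => attenuatedInflow C Ω qb z + attenuatedSource C Ω G z
  have hcoll : ∀ᵐ z ∂(phaseMeasure Ω), collision f μa μs C φ z = collision f μa μs C u z :=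
    hκ.collision_congr h.integrable h.ae_eq
  refine ⟨hφ, u, h.ae_eq.symm, ?_⟩
  filter_upwards [ae_phaseMeasure_mem hΩ.isOpen.measurableSet,
    ae_locallyIntegrable_indicator_flow hΩ.isOpen.measurableSet (h.integrable_add_collision hκ),
    ae_ae_flow_of_ae hΩ.isOpen.measurableSet hcoll] with z hz hloc hcz
  set v := dampedSolution C (-backTime Ω z) (attenuatedInflow C Ω qb z)
    fun s => (Prod.fst ⁻¹' Ω).indicator G (flow z s) with hv
  have hline : ∀ t, (flow z t).1 ∈ Ω → u (flow z t) = v t := fun t ht =>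
    hΩ.attenuatedInflow_add_attenuatedSource_flow hz ht
  have hv_entry : v (-backTime Ω z) = inflowExt Ω qb z := by
    rw [hv, dampedSolution, intervalIntegral.integral_same, add_zero, attenuatedInflow, ← mul_assoc,
      ← Real.exp_add, neg_mul_neg, add_neg_cancel, Real.exp_zero, one_mul]
  refine ⟨fun s t hst hmem => ?_, ?_, ?_⟩
  · refine absolutelyContinuousOnInterval_congr (v := v)
      (absolutelyContinuousOnInterval_dampedSolution C _ _ hloc s t) fun r hr => ?_
    exact (hline r (hmem r (uIcc_of_le hst ▸ hr))).symm
  · filter_upwards [ae_hasDerivAt_dampedSolution C (-backTime Ω z) (attenuatedInflow C Ω qb z) hloc,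
      hcz] with t hder hct ht
    have hnhds : (fun s => u (flow z s)) =ᶠ[𝓝 t] v := by
      filter_upwards [(isOpen_setOf_flow_mem hΩ.isOpen z).mem_nhds ht] using hline
    refine (hder.congr_of_eventuallyEq hnhds).congr_deriv ?_
    rw [← hv, ← hline t ht, indicator_of_mem (s := Prod.fst ⁻¹' Ω) ht, hct ht, collision]
    ring
  · rw [← hv_entry]
    refine ((continuous_dampedSolution C _ _ hloc).continuousWithinAt.tendsto).congr' ?_
    filter_upwards [hΩ.setOf_flow_mem_mem_nhdsGT hz] with t ht using (hline t ht).symm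

theorem change_absorption (h : IsMildSolution Ω f C μa₂ μs q J φ)
    (hκ₁ : IsCollisionKernel Ω f a C μa₁ μs κ₁) (hκ₂ : IsCollisionKernel Ω f a C μa₂ μs κ₂) :
    IsMildSolution Ω f C μa₁ μs (fun z => q z + (μa₁ z.1 - μa₂ z.1) * φ z) J φ := by
  have hsplit : ∀ z, (μa₁ z.1 - μa₂ z.1) * φ z
      = collision f μa₂ μs C φ z - collision f μa₁ μs C φ z := fun z => by
    simp only [collision]
    ring
  simp only [hsplit]
  refine ⟨h.integrable_source.add ((hκ₂.integrable_collision h.integrable).sub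
    (hκ₁.integrable_collision h.integrable)), h.integrable, ?_⟩
  simpa only [add_assoc, sub_add_cancel] using h.ae_eq

theorem sub (h₁ : IsMildSolution Ω f C μa μs q₁ J φ₁) (h₂ : IsMildSolution Ω f C μa μs q₂ J φ₂)
    (hΩ : IsConvexDomain Ω) (hκ : IsCollisionKernel Ω f a C μa μs κ) :
    IsMildSolution Ω f C μa μs (fun z => q₁ z - q₂ z) (fun _ => 0) (fun z => φ₁ z - φ₂ z) := by
  refine ⟨h₁.integrable_source.sub h₂.integrable_source, h₁.integrable.sub h₂.integrable, ?_⟩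
  have hsource : ∀ᵐ z ∂(phaseMeasure Ω),
      q₁ z + collision f μa μs C φ₁ z - (q₂ z + collision f μa μs C φ₂ z)
        = q₁ z - q₂ z + collision f μa μs C (fun y => φ₁ y - φ₂ y) z := by
    filter_upwards [hκ.collision_sub h₁.integrable h₂.integrable] with z hz
    rw [hz]
    ring
  filter_upwards [h₁.ae_eq, h₂.ae_eq, hΩ.attenuatedSource_sub (C := C)
    (h₁.integrable_add_collision hκ) (h₂.integrable_add_collision hκ),
    hΩ.attenuatedSource_congr (C := C) hsource] with z hz₁ hz₂ hsub hcongr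
  rw [← hcongr, hsub, hz₁, hz₂]
  ring

end IsMildSolution

/-- One step of source iteration for sources, free fields and densities with values in `[0, ∞]`:
the density `g` is scattered, added to the source `r` and streamed, on top of the free field `j`.
Its fixed points are the nonnegative mild solutions. -/
def sourceIteration (Ω : Set (Space d)) (C : ℝ)
    (κ : Kernel (Space d × Dir d) (Space d × Dir d)) (r j g : Space d × Dir d → ℝ≥0∞)
    (z : Space d × Dir d) : ℝ≥0∞ :=
  j z + streamed C Ω (fun y => r y + ∫⁻ x, g x ∂(κ y)) z

section SourceIteration

variable {r j g : Space d × Dir d → ℝ≥0∞}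

theorem sourceIteration_mono : Monotone (sourceIteration Ω C κ r j) := fun g g' h z => by
  unfold sourceIteration streamed
  gcongr with y
  dsimp only
  gcongr with x
  exact h x

theorem measurable_sourceIteration (hΩ : MeasurableSet Ω) (hr : Measurable r) (hj : Measurable j)
    (hg : Measurable g) : Measurable (sourceIteration Ω C κ r j g) :=
  hj.add (measurable_streamed hΩ (hr.add hg.lintegral_kernel))

theorem sourceIteration_iSup (hr : Measurable r) {g : ℕ → Space d × Dir d → ℝ≥0∞}
    (hg : ∀ n, Measurable (g n)) (hmono : Monotone g) :
    sourceIteration Ω C κ r j (⨆ n, g n) = ⨆ n, sourceIteration Ω C κ r j (g n) := by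
  have hscatter : ∀ y, r y + ∫⁻ x, (⨆ n, g n) x ∂(κ y) =
      ⨆ n, r y + ∫⁻ x, g n x ∂(κ y) := fun y => by
    simp only [iSup_apply, lintegral_iSup hg hmono, ENNReal.add_iSup]
  have hscatter_meas : ∀ n, Measurable fun y => r y + ∫⁻ x, g n x ∂(κ y) := fun n =>
    hr.add (hg n).lintegral_kernel
  have hscatter_mono : Monotone fun n y => r y + ∫⁻ x, g n x ∂(κ y) := fun m n hmn y => by
    dsimp only
    gcongr with x
    exact hmono hmn x
  ext z
  rw [iSup_apply]
  simp only [sourceIteration, streamed, hscatter]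
  rw [lintegral_iSup hscatter_meas hscatter_mono, ENNReal.add_iSup]

theorem eLpNorm_sourceIteration_le (hκ : IsCollisionKernel Ω f a C μa μs κ)
    (hΩ : MeasurableSet Ω) (hC : 0 < C) (hp : 1 ≤ p) (hr : Measurable r) (hj : Measurable j)
    (hg : Measurable g) :
    eLpNorm (sourceIteration Ω C κ r j g) p (phaseMeasure Ω)
      ≤ eLpNorm j p (phaseMeasure Ω) + (ENNReal.ofReal C)⁻¹ * (eLpNorm r p (phaseMeasure Ω)
        + ENNReal.ofReal (C - a) * eLpNorm g p (phaseMeasure Ω)) := by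
  have hκg : Measurable fun y => ∫⁻ x, g x ∂(κ y) := hg.lintegral_kernel
  refine (eLpNorm_add_le hj.aestronglyMeasurable
    (measurable_streamed hΩ (hr.add hκg)).aestronglyMeasurable hp).trans ?_
  gcongr
  refine (eLpNorm_streamed_le hC hΩ hp (hr.add hκg)).trans ?_
  gcongr
  refine (eLpNorm_add_le hr.aestronglyMeasurable hκg.aestronglyMeasurable hp).trans ?_
  gcongr
  exact hκ.eLpNorm_lintegral_le hp hg

theorem eq_zero_of_le_inv_mul_sub_mul (ha : 0 < a) (haC : a ≤ C) {x : ℝ≥0∞} (hx : x ≠ ∞)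
    (h : x ≤ (ENNReal.ofReal C)⁻¹ * (ENNReal.ofReal (C - a) * x)) : x = 0 := by
  have hC : 0 < C := ha.trans_le haC
  lift x to ℝ≥0 using hx
  rw [← ENNReal.ofReal_inv_of_pos hC, ← ENNReal.ofReal_coe_nnreal,
    ← ENNReal.ofReal_mul (by linarith), ← ENNReal.ofReal_mul (by positivity),
    ENNReal.ofReal_le_ofReal_iff (by have := sub_nonneg.2 haC; positivity), ← div_eq_inv_mul,
    le_div_iff₀ hC] at h
  have hxa : (x : ℝ) * a ≤ 0 := by linarith
  exact_mod_cast le_antisymm (nonpos_of_mul_nonpos_left hxa ha) x.2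

theorem add_inv_mul_add_sub_mul_eq (ha : 0 < a) (haC : a ≤ C) (x y : ℝ≥0∞) :
    x + (ENNReal.ofReal C)⁻¹ * (y + ENNReal.ofReal (C - a)
        * ((ENNReal.ofReal a)⁻¹ * (ENNReal.ofReal C * x + y)))
      = (ENNReal.ofReal a)⁻¹ * (ENNReal.ofReal C * x + y) := by
  have hA : ENNReal.ofReal a ≠ 0 := (ENNReal.ofReal_pos.2 ha).ne'
  have hC : ENNReal.ofReal C ≠ 0 := (ENNReal.ofReal_pos.2 (ha.trans_le haC)).ne'
  set B := (ENNReal.ofReal a)⁻¹ * (ENNReal.ofReal C * x + y) with hB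
  have hAB : ENNReal.ofReal a * B = ENNReal.ofReal C * x + y := by
    rw [hB, ← mul_assoc, ENNReal.mul_inv_cancel hA ENNReal.ofReal_ne_top, one_mul]
  calc x + (ENNReal.ofReal C)⁻¹ * (y + ENNReal.ofReal (C - a) * B)
      = (ENNReal.ofReal C)⁻¹ * (ENNReal.ofReal a * B + ENNReal.ofReal (C - a) * B) := by
        rw [hAB, add_assoc, mul_add _ (_ * x), ← mul_assoc _ _ x,
          ENNReal.inv_mul_cancel hC ENNReal.ofReal_ne_top, one_mul]
    _ = B := by
        rw [← add_mul, ← ENNReal.ofReal_add ha.le (sub_nonneg.2 haC), add_sub_cancel, ← mul_assoc,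
          ENNReal.inv_mul_cancel hC ENNReal.ofReal_ne_top, one_mul]

theorem IsCollisionKernel.exists_sourceIteration_eq (hκ : IsCollisionKernel Ω f a C μa μs κ)
    (hΩ : MeasurableSet Ω) (ha : 0 < a) (haC : a ≤ C) (hp : 1 ≤ p)
    (hr : Measurable r) (hj : Measurable j) :
    ∃ Φ, Measurable Φ ∧ sourceIteration Ω C κ r j Φ = Φ ∧
      eLpNorm Φ p (phaseMeasure Ω) ≤ (ENNReal.ofReal a)⁻¹ * (ENNReal.ofReal C
        * eLpNorm j p (phaseMeasure Ω) + eLpNorm r p (phaseMeasure Ω)) := by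
  refine exists_measurable_fixedPoint_eLpNorm_le sourceIteration_mono
    (fun g hg => measurable_sourceIteration hΩ hr hj hg)
    (fun g hg hmono => sourceIteration_iSup hr hg hmono) fun g hg hgB => ?_
  rw [← add_inv_mul_add_sub_mul_eq ha haC (eLpNorm j p (phaseMeasure Ω))]
  refine (eLpNorm_sourceIteration_le hκ hΩ (ha.trans_le haC) hp hr hj hg).trans ?_
  gcongr

end SourceIteration

end MildSolution

section Comparison

variable {Ω : Set (Space d)} {f : Dir d → Dir d → ℝ} {p : ℝ≥0∞} {a C : ℝ}
  {μa μa₁ μa₂ μs : Space d → ℝ} {q q₁ q₂ qb J φ φ₁ φ₂ : Space d × Dir d → ℝ}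
  {κ κ₁ κ₂ : Kernel (Space d × Dir d) (Space d × Dir d)}

namespace IsMildSolution

/-- The negative part of `φ` is a subsolution without source and free field, which the
contraction estimate forces to vanish. -/
theorem nonneg (h : IsMildSolution Ω f C μa μs q J φ) (hΩ : IsConvexDomain Ω)
    (hκ : IsCollisionKernel Ω f a C μa μs κ) (ha : 0 < a) (haC : a ≤ C)
    (hq : ∀ᵐ z ∂(phaseMeasure Ω), 0 ≤ q z) (hJ : ∀ᵐ z ∂(phaseMeasure Ω), 0 ≤ J z) :
    ∀ᵐ z ∂(phaseMeasure Ω), 0 ≤ φ z := by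
  obtain ⟨φ', hφ', hφφ'⟩ := h.integrable.aestronglyMeasurable
  set n : Space d × Dir d → ℝ≥0∞ := fun z => ENNReal.ofReal (-φ' z)
  have hn : Measurable n := hφ'.measurable.neg.ennreal_ofReal
  have hφn : ∀ᵐ z ∂(phaseMeasure Ω), ENNReal.ofReal (-φ z) = n z :=
    hφφ'.mono fun z hz => by rw [hz]
  have hκn : Measurable fun z => ∫⁻ y, n y ∂(κ z) := hn.lintegral_kernel
  have hsource : ∀ᵐ z ∂(phaseMeasure Ω),
      ENNReal.ofReal (-(q z + collision f μa μs C φ z)) ≤ ∫⁻ y, n y ∂(κ z) := by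
    filter_upwards [hq, hκ.ofReal_neg_collision_le h.integrable (hφn.mono fun z hz => hz.le)]
      with z hqz hcz
    exact (ENNReal.ofReal_le_ofReal (by linarith)).trans hcz
  have hsub : ∀ᵐ z ∂(phaseMeasure Ω), n z ≤ streamed C Ω (fun y => ∫⁻ x, n x ∂(κ y)) z := by
    filter_upwards [h.ae_eq, hJ, hφn, hΩ.ofReal_neg_attenuatedSource_le (C := C) hκn hsource]
      with z hz hJz hnz hle
    rw [← hnz, hz]
    exact (ENNReal.ofReal_le_ofReal (by linarith)).trans hle
  have hcontr : eLpNorm n 1 (phaseMeasure Ω) ≤ (ENNReal.ofReal C)⁻¹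
      * (ENNReal.ofReal (C - a) * eLpNorm n 1 (phaseMeasure Ω)) := by
    refine (eLpNorm_mono_enorm_ae hsub).trans
      ((eLpNorm_streamed_le (ha.trans_le haC) hΩ.isOpen.measurableSet le_rfl hκn).trans ?_)
    gcongr
    exact hκ.eLpNorm_lintegral_le le_rfl hn
  have hfin : eLpNorm n 1 (phaseMeasure Ω) ≠ ∞ := by
    refine ((eLpNorm_mono_enorm fun z => ?_).trans_lt
      (memLp_one_iff_integrable.2 (h.integrable.congr hφφ')).2).ne
    rw [enorm_eq_self, ← enorm_neg]
    exact Real.ofReal_le_enorm _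
  have hzero := eq_zero_of_le_inv_mul_sub_mul ha haC hfin hcontr
  rw [eLpNorm_one_eq_lintegral_enorm, lintegral_eq_zero_iff hn.enorm] at hzero
  filter_upwards [hzero, hφn] with z hz hnz
  rw [enorm_eq_self, ← hnz] at hz
  exact neg_nonpos.1 (ENNReal.ofReal_eq_zero.1 hz)

theorem pos_of_inflow (h : IsMildSolution Ω f C μa μs q J φ) (hΩ : IsConvexDomain Ω)
    (hκ : IsCollisionKernel Ω f a C μa μs κ) (ha : 0 < a) (haC : a ≤ C)
    (hq : ∀ᵐ z ∂(phaseMeasure Ω), 0 ≤ q z) (hJ : ∀ᵐ z ∂(phaseMeasure Ω), 0 < J z) :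
    ∀ᵐ z ∂(phaseMeasure Ω), 0 < φ z := by
  have hφ := h.nonneg hΩ hκ ha haC hq (hJ.mono fun z hz => hz.le)
  have hsource : ∀ᵐ z ∂(phaseMeasure Ω), 0 ≤ q z + collision f μa μs C φ z := by
    filter_upwards [hq, hκ.collision_nonneg h.integrable hφ] using fun z => add_nonneg
  filter_upwards [h.ae_eq, hJ, hΩ.attenuatedSource_nonneg (C := C) hsource] with z hz hJz hGz
  rw [hz]
  exact add_pos_of_pos_of_nonneg hJz hGz

theorem pos_of_source (h : IsMildSolution Ω f C μa μs q J φ) (hΩ : IsConvexDomain Ω)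
    (hκ : IsCollisionKernel Ω f a C μa μs κ) (ha : 0 < a) (haC : a ≤ C)
    (hq : ∀ᵐ z ∂(phaseMeasure Ω), 0 < q z) (hJ : ∀ᵐ z ∂(phaseMeasure Ω), 0 ≤ J z) :
    ∀ᵐ z ∂(phaseMeasure Ω), 0 < φ z := by
  have hφ := h.nonneg hΩ hκ ha haC (hq.mono fun z hz => hz.le) hJ
  have hsource : ∀ᵐ z ∂(phaseMeasure Ω), 0 < q z + collision f μa μs C φ z := by
    filter_upwards [hq, hκ.collision_nonneg h.integrable hφ]
      using fun z => add_pos_of_pos_of_nonneg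
  filter_upwards [h.ae_eq, hJ, hΩ.attenuatedSource_pos (C := C) (h.integrable_add_collision hκ)
    hsource] with z hz hJz hGz
  rw [hz]
  exact add_pos_of_nonneg_of_pos hJz hGz

end IsMildSolution

theorem memLp_toReal {α : Type*} [MeasurableSpace α] {m : Measure α} {g : α → ℝ≥0∞}
    (hg : Measurable g) (h : eLpNorm g p m < ∞) : MemLp (fun z => (g z).toReal) p m := by
  refine ⟨hg.ennreal_toReal.aestronglyMeasurable, (eLpNorm_mono_enorm fun z => ?_).trans_lt h⟩
  rw [Real.enorm_of_nonneg ENNReal.toReal_nonneg, enorm_eq_self]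
  exact ENNReal.ofReal_toReal_le

theorem exists_measurable_toReal_ae_eq {α : Type*} [MeasurableSpace α] {m : Measure α} {g : α → ℝ}
    (hg : MemLp g p m) (hnonneg : ∀ᵐ z ∂m, 0 ≤ g z) :
    ∃ g' : α → ℝ≥0∞, Measurable g' ∧ (∀ z, g' z < ∞) ∧ g =ᵐ[m] (fun z => (g' z).toReal) ∧
      eLpNorm g' p m < ∞ := by
  obtain ⟨g', hg', hgg'⟩ := hg.1
  refine ⟨fun z => ENNReal.ofReal (g' z), hg'.measurable.ennreal_ofReal,
    fun z => ENNReal.ofReal_lt_top, ?_, ?_⟩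
  · filter_upwards [hgg', hnonneg] with z hz hz0
    rw [ENNReal.toReal_ofReal (hz ▸ hz0), hz]
  · refine (eLpNorm_mono_enorm fun z => ?_).trans_lt (hg.ae_eq hgg').2
    rw [enorm_eq_self]
    exact Real.ofReal_le_enorm _

theorem ae_lt_top_of_eLpNorm_one_lt_top {α : Type*} [MeasurableSpace α] {m : Measure α}
    {g : α → ℝ≥0∞} (hg : Measurable g) (h : eLpNorm g 1 m < ∞) : ∀ᵐ z ∂m, g z < ∞ := by
  rw [eLpNorm_one_eq_lintegral_enorm] at h
  exact ae_lt_top hg h.ne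

theorem IsCollisionKernel.isMildSolution_of_sourceIteration_eq
    (hκ : IsCollisionKernel Ω f a C μa μs κ) (hΩ : IsConvexDomain Ω)
    {r j Φ : Space d × Dir d → ℝ≥0∞}
    (hr : Measurable r) (hr_fin : ∀ z, r z < ∞) (hΦ : Measurable Φ)
    (hΦ_norm : eLpNorm Φ 1 (phaseMeasure Ω) < ∞) (hfix : sourceIteration Ω C κ r j Φ = Φ)
    (hq : Integrable q (phaseMeasure Ω)) (hqr : q =ᵐ[phaseMeasure Ω] fun z => (r z).toReal)
    (hJj : J =ᵐ[phaseMeasure Ω] fun z => (j z).toReal) :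
    IsMildSolution Ω f C μa μs q J fun z => (Φ z).toReal := by
  have hφ : Integrable (fun z => (Φ z).toReal) (phaseMeasure Ω) :=
    memLp_one_iff_integrable.1 (memLp_toReal hΦ hΦ_norm)
  have hΦ_fin := ae_lt_top_of_eLpNorm_one_lt_top hΦ hΦ_norm
  have hκΦ : Measurable fun y => ∫⁻ x, Φ x ∂(κ y) := hΦ.lintegral_kernel
  have hκΦ_fin : ∀ᵐ z ∂(phaseMeasure Ω), ∫⁻ y, Φ y ∂(κ z) < ∞ :=
    ae_lt_top_of_eLpNorm_one_lt_top hκΦ ((hκ.eLpNorm_lintegral_le le_rfl hΦ).trans_lt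
      (ENNReal.mul_lt_top ENNReal.ofReal_lt_top hΦ_norm))
  set g : Space d × Dir d → ℝ≥0∞ := fun y => r y + ∫⁻ x, Φ x ∂(κ y)
  have hg : Measurable g := hr.add hκΦ
  have hsource : ∀ᵐ z ∂(phaseMeasure Ω),
      q z + collision f μa μs C (fun z => (Φ z).toReal) z = (g z).toReal := by
    filter_upwards [hqr, hκ.collision_toReal hΦ hφ hΦ_fin, hκΦ_fin] with z hqz hcz hz
    rw [hqz, hcz, ENNReal.toReal_add (hr_fin z).ne hz.ne]
  refine ⟨hq, hφ, ?_⟩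
  filter_upwards [hJj, hΩ.attenuatedSource_congr (C := C) hsource, hΦ_fin,
    hΩ.attenuatedSource_toReal (C := C) hg
      (hκΦ_fin.mono fun z hz => ENNReal.add_lt_top.2 ⟨hr_fin z, hz⟩)]
    with z hJz hcongr hz hstream
  have hΦz : Φ z = j z + streamed C Ω g z := (congrFun hfix z).symm
  rw [hΦz, ENNReal.add_lt_top] at hz
  rw [hcongr, hstream, hJz, hΦz, ENNReal.toReal_add hz.1.ne hz.2.ne]

theorem IsCollisionKernel.exists_isMildSolution (hκ : IsCollisionKernel Ω f a C μa μs κ)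
    (hΩ : IsConvexDomain Ω) (ha : 0 < a) (haC : a ≤ C) (hp : 1 ≤ p)
    (hq : MemLp q p (phaseMeasure Ω)) (hq0 : ∀ᵐ z ∂(phaseMeasure Ω), 0 ≤ q z)
    (hJ : MemLp J p (phaseMeasure Ω)) (hJ0 : ∀ᵐ z ∂(phaseMeasure Ω), 0 ≤ J z) :
    ∃ φ, MemLp φ p (phaseMeasure Ω) ∧ IsMildSolution Ω f C μa μs q J φ := by
  have : IsFiniteMeasure (phaseMeasure Ω) := isFiniteMeasure_phaseMeasure hΩ.isBounded
  obtain ⟨r, hr, hr_fin, hqr, hr_norm⟩ := exists_measurable_toReal_ae_eq hq hq0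
  obtain ⟨j, hj, _, hJj, hj_norm⟩ := exists_measurable_toReal_ae_eq hJ hJ0
  obtain ⟨Φ, hΦ, hfix, hΦ_le⟩ :=
    hκ.exists_sourceIteration_eq hΩ.isOpen.measurableSet ha haC hp hr hj
  have hΦ_norm : eLpNorm Φ p (phaseMeasure Ω) < ∞ := hΦ_le.trans_lt <|
    ENNReal.mul_lt_top (ENNReal.inv_lt_top.2 (ENNReal.ofReal_pos.2 ha))
      (ENNReal.add_lt_top.2 ⟨ENNReal.mul_lt_top ENNReal.ofReal_lt_top hj_norm, hr_norm⟩)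
  have hΦ_norm_one : eLpNorm Φ 1 (phaseMeasure Ω) < ∞ :=
    (MemLp.mono_exponent ⟨hΦ.aestronglyMeasurable, hΦ_norm⟩ hp).2
  exact ⟨_, memLp_toReal hΦ hΦ_norm, hκ.isMildSolution_of_sourceIteration_eq hΩ hr hr_fin hΦ
    hΦ_norm_one hfix (hq.integrable hp) hqr hJj⟩

theorem IsSubcritical.exists_isRTESolution (h : IsSubcritical Ω a C μa μs)
    (hΩ : IsConvexDomain Ω) (hf : IsScatteringKernel f) (hp : 1 ≤ p)
    (hq : MemLp q p (phaseMeasure Ω)) (hq0 : ∀ᵐ z ∂(phaseMeasure Ω), 0 ≤ q z)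
    (hqb : MemLp (inflowExt Ω qb) p (phaseMeasure Ω))
    (hqb0 : ∀ᵐ z ∂(phaseMeasure Ω), 0 ≤ inflowExt Ω qb z) :
    ∃ φ, IsRTESolution Ω f p μa μs q qb φ := by
  obtain ⟨κ, hκ⟩ := h.exists_isCollisionKernel hf
  obtain ⟨φ, hφ, hmild⟩ := hκ.exists_isMildSolution hΩ h.pos h.le hp hq hq0
    (hΩ.memLp_attenuatedInflow (h.pos.le.trans h.le) hqb)
    (hqb0.mono fun z hz => mul_nonneg (Real.exp_pos _).le hz)
  exact ⟨φ, hmild.isRTESolution hΩ hκ hφ⟩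

namespace IsRTESolution

theorem pos_of_inflow (h : IsRTESolution Ω f p μa μs q qb φ) (hΩ : IsConvexDomain Ω)
    (hf : IsScatteringKernel f) (hp : 1 ≤ p) (hsub : IsSubcritical Ω a C μa μs)
    (hq : Integrable q (phaseMeasure Ω)) (hq0 : ∀ᵐ z ∂(phaseMeasure Ω), 0 ≤ q z)
    (hqb : ∀ᵐ z ∂(phaseMeasure Ω), 0 < inflowExt Ω qb z) :
    ∀ᵐ z ∂(phaseMeasure Ω), 0 < φ z := by
  obtain ⟨κ, hκ⟩ := hsub.exists_isCollisionKernel hf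
  exact (h.isMildSolution hΩ hκ hp hq).pos_of_inflow hΩ hκ hsub.pos hsub.le hq0
    (hqb.mono fun z hz => mul_pos (Real.exp_pos _) hz)

theorem isMildSolution_sub (h₁ : IsRTESolution Ω f p μa₁ μs q₁ qb φ₁)
    (h₂ : IsRTESolution Ω f p μa₂ μs q₂ qb φ₂) (hΩ : IsConvexDomain Ω) (hp : 1 ≤ p)
    (hκ₁ : IsCollisionKernel Ω f a C μa₁ μs κ₁) (hκ₂ : IsCollisionKernel Ω f a C μa₂ μs κ₂)
    (hq₁ : Integrable q₁ (phaseMeasure Ω)) (hq₂ : Integrable q₂ (phaseMeasure Ω)) :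
    IsMildSolution Ω f C μa₁ μs (fun z => q₁ z - (q₂ z + (μa₁ z.1 - μa₂ z.1) * φ₂ z))
      (fun _ => 0) (fun z => φ₁ z - φ₂ z) :=
  (h₁.isMildSolution hΩ hκ₁ hp hq₁).sub
    ((h₂.isMildSolution hΩ hκ₂ hp hq₂).change_absorption hκ₁ hκ₂) hΩ hκ₁

theorem le_of_le_source (h₁ : IsRTESolution Ω f p μa₁ μs q₁ qb φ₁)
    (h₂ : IsRTESolution Ω f p μa₂ μs q₂ qb φ₂) (hΩ : IsConvexDomain Ω)
    (hf : IsScatteringKernel f) (hp : 1 ≤ p) (hsub₁ : IsSubcritical Ω a C μa₁ μs)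
    (hsub₂ : IsSubcritical Ω a C μa₂ μs) (hq₁ : Integrable q₁ (phaseMeasure Ω))
    (hq₂ : Integrable q₂ (phaseMeasure Ω))
    (hle : ∀ᵐ z ∂(phaseMeasure Ω), q₂ z + (μa₁ z.1 - μa₂ z.1) * φ₂ z ≤ q₁ z) :
    ∀ᵐ z ∂(phaseMeasure Ω), φ₂ z ≤ φ₁ z := by
  obtain ⟨κ₁, hκ₁⟩ := hsub₁.exists_isCollisionKernel hf
  obtain ⟨κ₂, hκ₂⟩ := hsub₂.exists_isCollisionKernel hf
  have hw := (h₁.isMildSolution_sub h₂ hΩ hp hκ₁ hκ₂ hq₁ hq₂).nonneg hΩ hκ₁ hsub₁.pos hsub₁.le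
    (hle.mono fun z => sub_nonneg.2) (ae_of_all _ fun _ => le_rfl)
  exact hw.mono fun z => sub_nonneg.1

theorem lt_of_lt_source (h₁ : IsRTESolution Ω f p μa₁ μs q₁ qb φ₁)
    (h₂ : IsRTESolution Ω f p μa₂ μs q₂ qb φ₂) (hΩ : IsConvexDomain Ω)
    (hf : IsScatteringKernel f) (hp : 1 ≤ p) (hsub₁ : IsSubcritical Ω a C μa₁ μs)
    (hsub₂ : IsSubcritical Ω a C μa₂ μs) (hq₁ : Integrable q₁ (phaseMeasure Ω))
    (hq₂ : Integrable q₂ (phaseMeasure Ω))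
    (hlt : ∀ᵐ z ∂(phaseMeasure Ω), q₂ z + (μa₁ z.1 - μa₂ z.1) * φ₂ z < q₁ z) :
    ∀ᵐ z ∂(phaseMeasure Ω), φ₂ z < φ₁ z := by
  obtain ⟨κ₁, hκ₁⟩ := hsub₁.exists_isCollisionKernel hf
  obtain ⟨κ₂, hκ₂⟩ := hsub₂.exists_isCollisionKernel hf
  have hw := (h₁.isMildSolution_sub h₂ hΩ hp hκ₁ hκ₂ hq₁ hq₂).pos_of_source hΩ hκ₁ hsub₁.pos
    hsub₁.le (hlt.mono fun z => sub_pos.2) (ae_of_all _ fun _ => le_rfl)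
  exact hw.mono fun z => sub_pos.1

end IsRTESolution

end Comparison

section AngularAverage

variable {Ω : Set (Space d)} {f : Dir d → Dir d → ℝ} {φ ψ : Space d × Dir d → ℝ}

theorem angularMeasure_ne_zero (hd : 0 < d) : angularMeasure d ≠ 0 := by
  rw [angularMeasure, Ne, Measure.toSphere_eq_zero_iff_finrank, finrank_euclideanSpace_fin]
  exact hd.ne'

theorem inv_angularMeasure_real_univ_pos (hd : 0 < d) : 0 < ((angularMeasure d).real univ)⁻¹ :=
  have : NeZero (angularMeasure d) := ⟨angularMeasure_ne_zero hd⟩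
  inv_pos.2 measureReal_univ_pos

theorem isScatteringKernel_const (hd : 0 < d) :
    IsScatteringKernel (d := d) fun _ _ => ((angularMeasure d).real univ)⁻¹ where
  measurable := measurable_const
  nonneg _ _ := (inv_angularMeasure_real_univ_pos hd).le
  symm _ _ := rfl
  integral_eq_one _ := by
    rw [integral_const, smul_eq_mul, mul_inv_cancel₀]
    exact (inv_pos.1 (inv_angularMeasure_real_univ_pos hd)).ne'

theorem angularMean_eq_scatter (φ : Space d × Dir d → ℝ) (z : Space d × Dir d) :
    angularMean φ z.1 = scatter (fun _ _ => ((angularMeasure d).real univ)⁻¹) φ z := by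
  rw [angularMean, angularInt, scatter, integral_const_mul]

theorem IsScatteringKernel.memLp_scatter (hf : IsScatteringKernel f) {p : ℝ≥0∞} (hp : 1 ≤ p)
    (hφ : MemLp φ p (phaseMeasure Ω)) : MemLp (scatter f φ) p (phaseMeasure Ω) := by
  have hm : StronglyMeasurable (hφ.1.mk φ) := hφ.1.stronglyMeasurable_mk
  have hscatter : (fun z => ∫ y, hφ.1.mk φ y ∂scatterKernel f z)
      =ᵐ[phaseMeasure Ω] scatter f φ := by
    simp_rw [hf.integral_scatterKernel]
    exact hf.scatter_congr hφ.1.ae_eq_mk.symm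
  refine (memLp_congr_ae hscatter).1 ⟨hm.integral_kernel.aestronglyMeasurable, ?_⟩
  calc eLpNorm (fun z => ∫ y, hφ.1.mk φ y ∂scatterKernel f z) p (phaseMeasure Ω)
      ≤ eLpNorm (fun z => ∫⁻ y, ‖hφ.1.mk φ y‖ₑ ∂scatterKernel f z) p (phaseMeasure Ω) :=
        eLpNorm_mono_enorm fun z => enorm_integral_le_lintegral_enorm _
    _ ≤ (1 : ℝ≥0) * eLpNorm (fun z => ‖hφ.1.mk φ z‖ₑ) p (phaseMeasure Ω) :=
        eLpNorm_lintegral_kernel_le (ae_of_all _ fun z => by simp [hf.scatterKernel_univ])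
          (by simp [hf.scatterKernel_comp_phaseMeasure]) hp hm.measurable.enorm
    _ = eLpNorm φ p (phaseMeasure Ω) := by
        rw [ENNReal.coe_one, one_mul, eLpNorm_enorm, eLpNorm_congr_ae hφ.1.ae_eq_mk.symm]
    _ < ∞ := hφ.2

theorem memLp_angularMean (hd : 0 < d) {p : ℝ≥0∞} (hp : 1 ≤ p) (hφ : MemLp φ p (phaseMeasure Ω)) :
    MemLp (fun z => angularMean φ z.1) p (phaseMeasure Ω) := by
  simp_rw [angularMean_eq_scatter]
  exact (isScatteringKernel_const hd).memLp_scatter hp hφ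

theorem angularInt_le (hφ : Integrable φ (phaseMeasure Ω)) (hψ : Integrable ψ (phaseMeasure Ω))
    (h : ∀ᵐ z ∂(phaseMeasure Ω), φ z ≤ ψ z) :
    ∀ᵐ x ∂(volume.restrict Ω), angularInt φ x ≤ angularInt ψ x := by
  filter_upwards [hφ.prod_right_ae, hψ.prod_right_ae, Measure.ae_ae_of_ae_prod h] with x hφx hψx hx
  exact integral_mono_ae hφx hψx hx

theorem angularInt_pos (hd : 0 < d) (hφ : Integrable φ (phaseMeasure Ω))
    (h : ∀ᵐ z ∂(phaseMeasure Ω), 0 < φ z) :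
    ∀ᵐ x ∂(volume.restrict Ω), 0 < angularInt φ x := by
  filter_upwards [hφ.prod_right_ae, Measure.ae_ae_of_ae_prod h] with x hφx hx
  have hsupport : Function.support (fun θ => φ (x, θ)) =ᵐ[angularMeasure d] univ :=
    eventuallyEq_univ.2 (hx.mono fun θ hθ => hθ.ne')
  rw [angularInt, integral_pos_iff_support_of_nonneg_ae (hx.mono fun θ hθ => hθ.le) hφx,
    measure_congr hsupport]
  exact Measure.measure_univ_pos.2 (angularMeasure_ne_zero hd)

theorem angularInt_lt (hd : 0 < d) (hφ : Integrable φ (phaseMeasure Ω))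
    (hψ : Integrable ψ (phaseMeasure Ω)) (h : ∀ᵐ z ∂(phaseMeasure Ω), φ z < ψ z) :
    ∀ᵐ x ∂(volume.restrict Ω), angularInt φ x < angularInt ψ x := by
  filter_upwards [angularInt_pos hd (hψ.sub hφ) (h.mono fun z hz => sub_pos.2 hz),
    hφ.prod_right_ae, hψ.prod_right_ae] with x hx hφx hψx
  exact sub_pos.1 (hx.trans_eq (integral_sub hψx hφx))

theorem angularMean_nonneg (h : ∀ᵐ z ∂(phaseMeasure Ω), 0 ≤ φ z) :
    ∀ᵐ x ∂(volume.restrict Ω), 0 ≤ angularMean φ x := by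
  filter_upwards [Measure.ae_ae_of_ae_prod h] with x hx
  exact mul_nonneg (inv_nonneg.2 measureReal_nonneg) (integral_nonneg_of_ae hx)

theorem angularMean_pos (hd : 0 < d) (hφ : Integrable φ (phaseMeasure Ω))
    (h : ∀ᵐ z ∂(phaseMeasure Ω), 0 < φ z) :
    ∀ᵐ x ∂(volume.restrict Ω), 0 < angularMean φ x :=
  (angularInt_pos hd hφ h).mono fun _ hx => mul_pos (inv_angularMeasure_real_univ_pos hd) hx

theorem angularMean_le (hφ : Integrable φ (phaseMeasure Ω)) (hψ : Integrable ψ (phaseMeasure Ω))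
    (h : ∀ᵐ z ∂(phaseMeasure Ω), φ z ≤ ψ z) :
    ∀ᵐ x ∂(volume.restrict Ω), angularMean φ x ≤ angularMean ψ x :=
  (angularInt_le hφ hψ h).mono fun _ hx =>
    mul_le_mul_of_nonneg_left hx (inv_nonneg.2 measureReal_nonneg)

end AngularAverage

section CoupledSystem

variable {Ω : Set (Space d)} {M : Medium d} {p : ℝ≥0∞} {c₁ c₂ : ℝ} {μ μ₁ μ₂ : Space d → ℝ}
  {φx φx₁ φx₂ φm₁ φm₂ : Space d × Dir d → ℝ}

theorem IsCoeff.add {b₁ b₂ : ℝ} (h₁ : IsCoeff Ω b₁ c₁ μ₁) (h₂ : IsCoeff Ω b₂ c₂ μ₂) :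
    IsCoeff Ω (b₁ + b₂) (c₁ + c₂) fun x => μ₁ x + μ₂ x where
  aestronglyMeasurable := h₁.aestronglyMeasurable.add h₂.aestronglyMeasurable
  bounds := by
    filter_upwards [h₁.bounds, h₂.bounds] with x hx₁ hx₂
    exact ⟨add_le_add hx₁.1 hx₂.1, add_le_add hx₁.2 hx₂.2⟩

theorem IsCoeff.ae_pos (h : IsCoeff Ω c₁ c₂ μ) (hc₁ : 0 < c₁) :
    ∀ᵐ x ∂(volume.restrict Ω), 0 < μ x :=
  h.bounds.mono fun _ hx => hc₁.trans_le hx.1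

theorem IsCoeff.isSubcritical {b₁ b₂ : ℝ} (ha : IsCoeff Ω b₁ c₁ μ₁) (hs : IsCoeff Ω b₂ c₂ μ₂)
    (hb₁ : 0 < b₁) (hb₂ : 0 ≤ b₂) : IsSubcritical Ω b₁ (b₁ + |c₁| + |c₂|) μ₁ μ₂ where
  pos := hb₁
  le := by linarith [abs_nonneg c₁, abs_nonneg c₂]
  aestronglyMeasurable_absorption := ha.aestronglyMeasurable
  aestronglyMeasurable_scattering := hs.aestronglyMeasurable
  bounds := by
    filter_upwards [ha.bounds, hs.bounds] with x hxa hxs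
    exact ⟨hxa.1, hb₂.trans hxs.1, by linarith [le_abs_self c₁, le_abs_self c₂]⟩

/-- The source `η μ (Ã φx)` of the emission equation. -/
def Medium.emissionSource (M : Medium d) (μ : Space d → ℝ) (φx : Space d × Dir d → ℝ)
    (z : Space d × Dir d) : ℝ :=
  M.η z.1 * μ z.1 * angularMean φx z.1

namespace Medium.Admissible

theorem isConvexDomain (hM : M.Admissible p c₁ c₂) : IsConvexDomain M.Ω :=
  ⟨hM.isOpen, hM.isBounded, hM.convex⟩

theorem integrable (hM : M.Admissible p c₁ c₂) (hp : 1 ≤ p) {φ : Space d × Dir d → ℝ}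
    (hφ : MemLp φ p (phaseMeasure M.Ω)) : Integrable φ (phaseMeasure M.Ω) :=
  have := isFiniteMeasure_phaseMeasure hM.isBounded
  hφ.integrable hp

theorem isSubcritical_excitation (hM : M.Admissible p c₁ c₂) (hμ : IsCoeff M.Ω c₁ c₂ μ) :
    IsSubcritical M.Ω (c₁ + c₁) (c₁ + c₁ + |c₂ + c₂| + |c₂|) (fun x => M.μaxi x + μ x) M.μsx :=
  (hM.μaxi.add hμ).isSubcritical hM.μsx (add_pos hM.c₁_pos hM.c₁_pos) hM.c₁_pos.le

theorem isSubcritical_emission (hM : M.Admissible p c₁ c₂) :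
    IsSubcritical M.Ω c₁ (c₁ + |c₂| + |c₂|) M.μam M.μsm :=
  hM.μam.isSubcritical hM.μsm hM.c₁_pos hM.c₁_pos.le

theorem exists_isExcitation (hM : M.Admissible p c₁ c₂) (hp : 1 ≤ p)
    (hμ : IsCoeff M.Ω c₁ c₂ μ) : ∃ φx, M.IsExcitation p μ φx :=
  (hM.isSubcritical_excitation hμ).exists_isRTESolution hM.isConvexDomain hM.kernel hp
    MemLp.zero' (ae_of_all _ fun _ => le_rfl) hM.qb_memLp (hM.qb_pos.mono fun _ hz => hz.le)

theorem excitation_pos (hM : M.Admissible p c₁ c₂) (hp : 1 ≤ p) (hμ : IsCoeff M.Ω c₁ c₂ μ)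
    (h : M.IsExcitation p μ φx) : ∀ᵐ z ∂(phaseMeasure M.Ω), 0 < φx z :=
  IsRTESolution.pos_of_inflow h hM.isConvexDomain hM.kernel hp (hM.isSubcritical_excitation hμ)
    (integrable_zero _ _ _) (ae_of_all _ fun _ => le_rfl) hM.qb_pos

theorem excitation_le (hM : M.Admissible p c₁ c₂) (hp : 1 ≤ p)
    (hμ₁ : IsCoeff M.Ω c₁ c₂ μ₁) (hμ₂ : IsCoeff M.Ω c₁ c₂ μ₂)
    (h₁ : M.IsExcitation p μ₁ φx₁) (h₂ : M.IsExcitation p μ₂ φx₂)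
    (hμ : ∀ᵐ x ∂(volume.restrict M.Ω), μ₁ x ≤ μ₂ x) :
    ∀ᵐ z ∂(phaseMeasure M.Ω), φx₂ z ≤ φx₁ z := by
  refine IsRTESolution.le_of_le_source h₁ h₂ hM.isConvexDomain hM.kernel hp
    (hM.isSubcritical_excitation hμ₁) (hM.isSubcritical_excitation hμ₂)
    (integrable_zero _ _ _) (integrable_zero _ _ _) ?_
  filter_upwards [hM.excitation_pos hp hμ₂ h₂, ae_phaseMeasure_of_ae hμ] with z hz hμz
  linarith [mul_nonneg (sub_nonneg.2 hμz) hz.le]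

theorem excitation_lt (hM : M.Admissible p c₁ c₂) (hp : 1 ≤ p)
    (hμ₁ : IsCoeff M.Ω c₁ c₂ μ₁) (hμ₂ : IsCoeff M.Ω c₁ c₂ μ₂)
    (h₁ : M.IsExcitation p μ₁ φx₁) (h₂ : M.IsExcitation p μ₂ φx₂)
    (hμ : ∀ᵐ x ∂(volume.restrict M.Ω), μ₁ x < μ₂ x) :
    ∀ᵐ z ∂(phaseMeasure M.Ω), φx₂ z < φx₁ z := by
  refine IsRTESolution.lt_of_lt_source h₁ h₂ hM.isConvexDomain hM.kernel hp
    (hM.isSubcritical_excitation hμ₁) (hM.isSubcritical_excitation hμ₂)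
    (integrable_zero _ _ _) (integrable_zero _ _ _) ?_
  filter_upwards [hM.excitation_pos hp hμ₂ h₂, ae_phaseMeasure_of_ae hμ] with z hz hμz
  linarith [mul_pos (sub_pos.2 hμz) hz]

theorem memLp_emissionSource (hM : M.Admissible p c₁ c₂) (hd : 0 < d) (hp : 1 ≤ p)
    (hμ : IsCoeff M.Ω c₁ c₂ μ) (hφ : MemLp φx p (phaseMeasure M.Ω)) :
    MemLp (M.emissionSource μ φx) p (phaseMeasure M.Ω) := by
  have hmean := memLp_angularMean hd hp hφ
  refine hmean.of_le_mul (c := c₂)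
    ((hM.η_meas.comp_fst.mul hμ.aestronglyMeasurable.comp_fst).mul hmean.1) ?_
  filter_upwards [ae_phaseMeasure_of_ae hM.η_bounds, ae_phaseMeasure_of_ae (hμ.ae_pos hM.c₁_pos),
    ae_phaseMeasure_of_ae hμ.bounds] with z hη hpos hμz
  rw [emissionSource, norm_mul, Real.norm_of_nonneg (mul_nonneg hη.1 hpos.le)]
  gcongr
  exact (mul_le_of_le_one_left hpos.le hη.2.le).trans hμz.2

theorem emissionSource_le (hM : M.Admissible p c₁ c₂) (hμ₁ : IsCoeff M.Ω c₁ c₂ μ₁)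
    (hφ₁ : Integrable φx₁ (phaseMeasure M.Ω)) (hφ₂ : Integrable φx₂ (phaseMeasure M.Ω))
    (hμ : ∀ᵐ x ∂(volume.restrict M.Ω), μ₁ x ≤ μ₂ x)
    (hφ : ∀ᵐ z ∂(phaseMeasure M.Ω), φx₁ z ≤ φx₂ z) (hφ0 : ∀ᵐ z ∂(phaseMeasure M.Ω), 0 ≤ φx₁ z) :
    ∀ᵐ z ∂(phaseMeasure M.Ω), M.emissionSource μ₁ φx₁ z ≤ M.emissionSource μ₂ φx₂ z := by
  filter_upwards [ae_phaseMeasure_of_ae hM.η_bounds, ae_phaseMeasure_of_ae (hμ₁.ae_pos hM.c₁_pos),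
    ae_phaseMeasure_of_ae hμ, ae_phaseMeasure_of_ae (angularMean_nonneg hφ0),
    ae_phaseMeasure_of_ae (angularMean_le hφ₁ hφ₂ hφ)] with z hη hpos hμz hmean hmean_le
  exact mul_le_mul (mul_le_mul_of_nonneg_left hμz hη.1) hmean_le hmean
    (mul_nonneg hη.1 (hpos.le.trans hμz))

theorem emissionSource_lt (hM : M.Admissible p c₁ c₂) (hd : 0 < d) (hμ₁ : IsCoeff M.Ω c₁ c₂ μ₁)
    (hφ₁ : Integrable φx₁ (phaseMeasure M.Ω)) (hφ₂ : Integrable φx₂ (phaseMeasure M.Ω))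
    (hμ : ∀ᵐ x ∂(volume.restrict M.Ω), μ₁ x < μ₂ x)
    (hφ : ∀ᵐ z ∂(phaseMeasure M.Ω), φx₁ z ≤ φx₂ z) (hφ0 : ∀ᵐ z ∂(phaseMeasure M.Ω), 0 < φx₁ z)
    (hη : ∀ᵐ x ∂(volume.restrict M.Ω), 0 < M.η x) :
    ∀ᵐ z ∂(phaseMeasure M.Ω), M.emissionSource μ₁ φx₁ z < M.emissionSource μ₂ φx₂ z := by
  filter_upwards [ae_phaseMeasure_of_ae hη, ae_phaseMeasure_of_ae (hμ₁.ae_pos hM.c₁_pos),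
    ae_phaseMeasure_of_ae hμ, ae_phaseMeasure_of_ae (angularMean_pos hd hφ₁ hφ0),
    ae_phaseMeasure_of_ae (angularMean_le hφ₁ hφ₂ hφ)] with z hη hpos hμz hmean hmean_le
  exact mul_lt_mul (mul_lt_mul_of_pos_left hμz hη) hmean_le hmean
    (mul_pos hη (hpos.trans hμz)).le

theorem exists_isEmission (hM : M.Admissible p c₁ c₂) (hd : 0 < d) (hp : 1 ≤ p)
    (hμ : IsCoeff M.Ω c₁ c₂ μ) (hφ : MemLp φx p (phaseMeasure M.Ω))
    (hφ0 : ∀ᵐ z ∂(phaseMeasure M.Ω), 0 ≤ φx z) : ∃ φm, M.IsEmission p μ φx φm := by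
  refine hM.isSubcritical_emission.exists_isRTESolution hM.isConvexDomain hM.kernel hp
    (hM.memLp_emissionSource hd hp hμ hφ) ?_ MemLp.zero' (ae_of_all _ fun _ => le_rfl)
  filter_upwards [ae_phaseMeasure_of_ae hM.η_bounds, ae_phaseMeasure_of_ae (hμ.ae_pos hM.c₁_pos),
    ae_phaseMeasure_of_ae (angularMean_nonneg hφ0)] with z hη hpos hmean
  exact mul_nonneg (mul_nonneg hη.1 hpos.le) hmean

theorem emission_le (hM : M.Admissible p c₁ c₂) (hd : 0 < d) (hp : 1 ≤ p)
    (hμ₁ : IsCoeff M.Ω c₁ c₂ μ₁) (hμ₂ : IsCoeff M.Ω c₁ c₂ μ₂)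
    (hφ₁ : MemLp φx₁ p (phaseMeasure M.Ω)) (hφ₂ : MemLp φx₂ p (phaseMeasure M.Ω))
    (h₁ : M.IsEmission p μ₁ φx₁ φm₁) (h₂ : M.IsEmission p μ₂ φx₂ φm₂)
    (hμ : ∀ᵐ x ∂(volume.restrict M.Ω), μ₁ x ≤ μ₂ x)
    (hφ : ∀ᵐ z ∂(phaseMeasure M.Ω), φx₁ z ≤ φx₂ z) (hφ0 : ∀ᵐ z ∂(phaseMeasure M.Ω), 0 ≤ φx₁ z) :
    ∀ᵐ z ∂(phaseMeasure M.Ω), φm₁ z ≤ φm₂ z := by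
  refine IsRTESolution.le_of_le_source h₂ h₁ hM.isConvexDomain hM.kernel hp
    hM.isSubcritical_emission hM.isSubcritical_emission
    (hM.integrable hp (hM.memLp_emissionSource hd hp hμ₂ hφ₂))
    (hM.integrable hp (hM.memLp_emissionSource hd hp hμ₁ hφ₁)) ?_
  simpa only [sub_self, zero_mul, add_zero, emissionSource] using
    hM.emissionSource_le hμ₁ (hM.integrable hp hφ₁) (hM.integrable hp hφ₂) hμ hφ hφ0

theorem emission_lt (hM : M.Admissible p c₁ c₂) (hd : 0 < d) (hp : 1 ≤ p)
    (hμ₁ : IsCoeff M.Ω c₁ c₂ μ₁) (hμ₂ : IsCoeff M.Ω c₁ c₂ μ₂)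
    (hφ₁ : MemLp φx₁ p (phaseMeasure M.Ω)) (hφ₂ : MemLp φx₂ p (phaseMeasure M.Ω))
    (h₁ : M.IsEmission p μ₁ φx₁ φm₁) (h₂ : M.IsEmission p μ₂ φx₂ φm₂)
    (hμ : ∀ᵐ x ∂(volume.restrict M.Ω), μ₁ x < μ₂ x)
    (hφ : ∀ᵐ z ∂(phaseMeasure M.Ω), φx₁ z ≤ φx₂ z) (hφ0 : ∀ᵐ z ∂(phaseMeasure M.Ω), 0 < φx₁ z)
    (hη : ∀ᵐ x ∂(volume.restrict M.Ω), 0 < M.η x) :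
    ∀ᵐ z ∂(phaseMeasure M.Ω), φm₁ z < φm₂ z := by
  refine IsRTESolution.lt_of_lt_source h₂ h₁ hM.isConvexDomain hM.kernel hp
    hM.isSubcritical_emission hM.isSubcritical_emission
    (hM.integrable hp (hM.memLp_emissionSource hd hp hμ₂ hφ₂))
    (hM.integrable hp (hM.memLp_emissionSource hd hp hμ₁ hφ₁)) ?_
  simpa only [sub_self, zero_mul, add_zero, emissionSource] using
    hM.emissionSource_lt hd hμ₁ (hM.integrable hp hφ₁) (hM.integrable hp hφ₂) hμ hφ hφ0 hη

theorem exists_isSolution (hM : M.Admissible p c₁ c₂) (hd : 0 < d) (hp : 1 ≤ p)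
    (hμ : IsCoeff M.Ω c₁ c₂ μ) : ∃ φx φm, M.IsSolution p μ φx φm := by
  obtain ⟨φx, hx⟩ := hM.exists_isExcitation hp hμ
  obtain ⟨φm, hm⟩ := hM.exists_isEmission hd hp hμ hx.memLp
    ((hM.excitation_pos hp hμ hx).mono fun _ hz => hz.le)
  exact ⟨φx, φm, hx, hm⟩

end Medium.Admissible

end CoupledSystem

section Squeeze

variable {Ω : Set (Space d)} {M : Medium d} {p : ℝ≥0∞} {c₁ c₂ : ℝ}
  {μ ν μlo μhi μlo' μhi' g : Space d → ℝ}
  {φx φm φx' φm' φxlo φxhi φmlo φmhi φxlo' φxhi' φmlo' φmhi' : Space d × Dir d → ℝ}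

theorem Medium.update_energy_le {x : Space d} (hη : M.η x < 1) (hm : 0 ≤ M.μaxi x)
    (hμ : 0 ≤ μ x) (ha : 0 ≤ M.μam x) (hpos : 0 < angularInt φx' x)
    (hx : angularInt φx x ≤ angularInt φx' x) (hm' : angularInt φm x ≤ angularInt φm' x) :
    M.update (M.energy μ φx φm) φx' φm' x ≤ μ x := by
  have hη' : 0 < 1 - M.η x := sub_pos.2 hη
  have hquot : (M.energy μ φx φm x - M.μam x * angularInt φm' x) / angularInt φx' x
      ≤ M.μaxi x + (1 - M.η x) * μ x := by
    rw [div_le_iff₀ hpos, energy]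
    have := mul_le_mul_of_nonneg_left hx (add_nonneg hm (mul_nonneg hη'.le hμ))
    have := mul_le_mul_of_nonneg_left hm' ha
    linarith
  rw [update, one_div, inv_mul_le_iff₀ hη']
  linarith

theorem Medium.lt_update_energy {x : Space d} (hη : M.η x < 1) (hm : 0 < M.μaxi x)
    (hμ : 0 ≤ μ x) (ha : 0 ≤ M.μam x) (hpos : 0 < angularInt φx' x)
    (hx : angularInt φx' x < angularInt φx x) (hm' : angularInt φm' x ≤ angularInt φm x) :
    μ x < M.update (M.energy μ φx φm) φx' φm' x := by
  have hη' : 0 < 1 - M.η x := sub_pos.2 hη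
  have hquot : M.μaxi x + (1 - M.η x) * μ x
      < (M.energy μ φx φm x - M.μam x * angularInt φm' x) / angularInt φx' x := by
    rw [lt_div_iff₀ hpos, energy]
    have := mul_lt_mul_of_pos_left hx (add_pos_of_pos_of_nonneg hm (mul_nonneg hη'.le hμ))
    have := mul_le_mul_of_nonneg_left hm' ha
    linarith
  rw [update, one_div, lt_inv_mul_iff₀ hη']
  linarith

theorem Medium.Admissible.aestronglyMeasurable_update (hM : M.Admissible p c₁ c₂)
    (hμ : AEStronglyMeasurable μ (volume.restrict M.Ω))
    (hφx : Integrable φx (phaseMeasure M.Ω)) (hφm : Integrable φm (phaseMeasure M.Ω))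
    (hφx' : Integrable φx' (phaseMeasure M.Ω)) (hφm' : Integrable φm' (phaseMeasure M.Ω)) :
    AEStronglyMeasurable (M.update (M.energy μ φx φm) φx' φm') (volume.restrict M.Ω) := by
  have hA {φ : Space d × Dir d → ℝ} (hφ : Integrable φ (phaseMeasure M.Ω)) :
      AEMeasurable (angularInt φ) (volume.restrict M.Ω) := hφ.integral_prod_left.1.aemeasurable
  have hμ := hμ.aemeasurable
  have hη := hM.η_meas.aemeasurable
  have hμaxi := hM.μaxi.aestronglyMeasurable.aemeasurable
  have hμam := hM.μam.aestronglyMeasurable.aemeasurable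
  have := hA hφx
  have := hA hφm
  have := hA hφx'
  have := hA hφm'
  refine AEMeasurable.aestronglyMeasurable ?_
  unfold Medium.update Medium.energy
  fun_prop

/-- The fields computed from the bounds `μlo`, `μhi` at one stage of the squeeze iteration. The
bounds `φmlo`, `φmhi` on the emission are driven by the opposite excitations, since `φx` decreases
with `μ`. -/
structure Medium.IsStage (M : Medium d) (p : ℝ≥0∞) (μlo μhi : Space d → ℝ)
    (φxlo φxhi φmlo φmhi : Space d × Dir d → ℝ) : Prop where
  excitation_lo : M.IsExcitation p μlo φxlo
  excitation_hi : M.IsExcitation p μhi φxhi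
  emission_hi : M.IsEmission p μhi φxlo φmhi
  emission_lo : M.IsEmission p μlo φxhi φmlo

/-- The enclosure `μlo ≤ μ < μhi` of the unknown coefficient `μ`, which the squeeze iteration
preserves. -/
structure IsBracket (Ω : Set (Space d)) (c₁ c₂ : ℝ) (μ μlo μhi : Space d → ℝ) : Prop where
  lo : IsCoeff Ω c₁ c₂ μlo
  hi : IsCoeff Ω c₁ c₂ μhi
  lo_le : ∀ᵐ x ∂(volume.restrict Ω), μlo x ≤ μ x
  lt_hi : ∀ᵐ x ∂(volume.restrict Ω), μ x < μhi x

theorem Medium.IsSolution.isStage (h : M.IsSolution p μ φx φm) :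
    M.IsStage p μ μ φx φx φm φm :=
  ⟨h.1, h.1, h.2, h.2⟩

theorem Medium.IsSIM.isStage {h : Space d → ℝ} {s : Iterates d} (hs : M.IsSIM p c₁ c₂ h s)
    (i : ℕ) : M.IsStage p (s.μlo i) (s.μhi i) (s.φxlo i) (s.φxhi i) (s.φmlo i) (s.φmhi i) :=
  ⟨hs.excitation_lo i, hs.excitation_hi i, hs.emission_hi i, hs.emission_lo i⟩

theorem Medium.IsSIM.lo_le_succ {h : Space d → ℝ} {s : Iterates d} (hs : M.IsSIM p c₁ c₂ h s)
    (i : ℕ) : ∀ᵐ x ∂(volume.restrict M.Ω), s.μlo i x ≤ s.μlo (i + 1) x :=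
  (hs.lo_succ i).mono fun _ hx => hx ▸ le_max_left _ _

theorem Medium.IsSIM.hi_succ_le {h : Space d → ℝ} {s : Iterates d} (hs : M.IsSIM p c₁ c₂ h s)
    (i : ℕ) : ∀ᵐ x ∂(volume.restrict M.Ω), s.μhi (i + 1) x ≤ s.μhi i x :=
  (hs.hi_succ i).mono fun _ hx => hx ▸ min_le_left _ _

theorem Medium.Admissible.exists_isStage (hM : M.Admissible p c₁ c₂) (hd : 0 < d) (hp : 1 ≤ p)
    (hlo : IsCoeff M.Ω c₁ c₂ μlo) (hhi : IsCoeff M.Ω c₁ c₂ μhi) :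
    ∃ φxlo φxhi φmlo φmhi, M.IsStage p μlo μhi φxlo φxhi φmlo φmhi := by
  obtain ⟨φxlo, hxlo⟩ := hM.exists_isExcitation hp hlo
  obtain ⟨φxhi, hxhi⟩ := hM.exists_isExcitation hp hhi
  obtain ⟨φmhi, hmhi⟩ := hM.exists_isEmission hd hp hhi hxlo.memLp
    ((hM.excitation_pos hp hlo hxlo).mono fun _ hz => hz.le)
  obtain ⟨φmlo, hmlo⟩ := hM.exists_isEmission hd hp hlo hxhi.memLp
    ((hM.excitation_pos hp hhi hxhi).mono fun _ hz => hz.le)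
  exact ⟨φxlo, φxhi, φmlo, φmhi, hxlo, hxhi, hmhi, hmlo⟩

namespace Medium.IsStage

theorem mono (hM : M.Admissible p c₁ c₂) (hd : 0 < d) (hp : 1 ≤ p)
    (hlo : IsCoeff M.Ω c₁ c₂ μlo) (hhi : IsCoeff M.Ω c₁ c₂ μhi)
    (hlo' : IsCoeff M.Ω c₁ c₂ μlo') (hhi' : IsCoeff M.Ω c₁ c₂ μhi')
    (h : M.IsStage p μlo μhi φxlo φxhi φmlo φmhi)
    (h' : M.IsStage p μlo' μhi' φxlo' φxhi' φmlo' φmhi')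
    (hle : ∀ᵐ x ∂(volume.restrict M.Ω), μlo x ≤ μlo' x)
    (hge : ∀ᵐ x ∂(volume.restrict M.Ω), μhi' x ≤ μhi x) :
    ∀ᵐ z ∂(phaseMeasure M.Ω), φxlo' z ≤ φxlo z ∧ φxhi z ≤ φxhi' z ∧
      φmlo z ≤ φmlo' z ∧ φmhi' z ≤ φmhi z := by
  have hxlo := hM.excitation_le hp hlo hlo' h.excitation_lo h'.excitation_lo hle
  have hxhi := hM.excitation_le hp hhi' hhi h'.excitation_hi h.excitation_hi hge
  have hmlo := hM.emission_le hd hp hlo hlo' h.excitation_hi.memLp h'.excitation_hi.memLp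
    h.emission_lo h'.emission_lo hle hxhi
    ((hM.excitation_pos hp hhi h.excitation_hi).mono fun _ hz => hz.le)
  have hmhi := hM.emission_le hd hp hhi' hhi h'.excitation_lo.memLp h.excitation_lo.memLp
    h'.emission_hi h.emission_hi hge hxlo
    ((hM.excitation_pos hp hlo' h'.excitation_lo).mono fun _ hz => hz.le)
  filter_upwards [hxlo, hxhi, hmlo, hmhi] with z h₁ h₂ h₃ h₄ using ⟨h₁, h₂, h₃, h₄⟩

theorem encloses (hM : M.Admissible p c₁ c₂) (hd : 0 < d) (hp : 1 ≤ p)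
    (hμ : IsCoeff M.Ω c₁ c₂ μ) (hsol : M.IsSolution p μ φx φm)
    (hbr : IsBracket M.Ω c₁ c₂ μ μlo μhi) (h : M.IsStage p μlo μhi φxlo φxhi φmlo φmhi) :
    ∀ᵐ z ∂(phaseMeasure M.Ω), φx z ≤ φxlo z ∧ φxhi z ≤ φx z ∧ φmlo z ≤ φm z ∧ φm z ≤ φmhi z :=
  h.mono hM hd hp hbr.lo hbr.hi hμ hμ hsol.isStage hbr.lo_le (hbr.lt_hi.mono fun _ hx => hx.le)

theorem emission_lt_hi (hM : M.Admissible p c₁ c₂) (hd : 0 < d) (hp : 1 ≤ p)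
    (hμ : IsCoeff M.Ω c₁ c₂ μ) (hsol : M.IsSolution p μ φx φm)
    (hbr : IsBracket M.Ω c₁ c₂ μ μlo μhi) (h : M.IsStage p μlo μhi φxlo φxhi φmlo φmhi)
    (hη : ∀ᵐ x ∂(volume.restrict M.Ω), 0 < M.η x) :
    ∀ᵐ z ∂(phaseMeasure M.Ω), φm z < φmhi z :=
  hM.emission_lt hd hp hμ hbr.hi hsol.1.memLp h.excitation_lo.memLp hsol.2 h.emission_hi
    hbr.lt_hi (hM.excitation_le hp hbr.lo hμ h.excitation_lo hsol.1 hbr.lo_le)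
    (hM.excitation_pos hp hμ hsol.1) hη

theorem update_lo_le (hM : M.Admissible p c₁ c₂) (hd : 0 < d) (hp : 1 ≤ p)
    (hμ : IsCoeff M.Ω c₁ c₂ μ) (hsol : M.IsSolution p μ φx φm)
    (hbr : IsBracket M.Ω c₁ c₂ μ μlo μhi) (h : M.IsStage p μlo μhi φxlo φxhi φmlo φmhi) :
    ∀ᵐ x ∂(volume.restrict M.Ω), M.update (M.energy μ φx φm) φxlo φmhi x ≤ μ x := by
  have hencl := h.encloses hM hd hp hμ hsol hbr
  have hφxlo := hM.integrable hp h.excitation_lo.memLp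
  filter_upwards [hM.η_bounds, hM.μaxi.ae_pos hM.c₁_pos, hμ.ae_pos hM.c₁_pos,
    hM.μam.ae_pos hM.c₁_pos, angularInt_pos hd hφxlo (hM.excitation_pos hp hbr.lo h.excitation_lo),
    angularInt_le (hM.integrable hp hsol.1.memLp) hφxlo (hencl.mono fun _ hz => hz.1),
    angularInt_le (hM.integrable hp hsol.2.memLp) (hM.integrable hp h.emission_hi.memLp)
      (hencl.mono fun _ hz => hz.2.2.2)] with x hη hμaxi hμ hμam hpos hx hm
  exact update_energy_le hη.2 hμaxi.le hμ.le hμam.le hpos hx hm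

theorem lt_update_hi (hM : M.Admissible p c₁ c₂) (hd : 0 < d) (hp : 1 ≤ p)
    (hμ : IsCoeff M.Ω c₁ c₂ μ) (hsol : M.IsSolution p μ φx φm)
    (hbr : IsBracket M.Ω c₁ c₂ μ μlo μhi) (h : M.IsStage p μlo μhi φxlo φxhi φmlo φmhi) :
    ∀ᵐ x ∂(volume.restrict M.Ω), μ x < M.update (M.energy μ φx φm) φxhi φmlo x := by
  have hencl := h.encloses hM hd hp hμ hsol hbr
  have hlt := hM.excitation_lt hp hμ hbr.hi hsol.1 h.excitation_hi hbr.lt_hi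
  have hφxhi := hM.integrable hp h.excitation_hi.memLp
  filter_upwards [hM.η_bounds, hM.μaxi.ae_pos hM.c₁_pos, hμ.ae_pos hM.c₁_pos,
    hM.μam.ae_pos hM.c₁_pos, angularInt_pos hd hφxhi (hM.excitation_pos hp hbr.hi h.excitation_hi),
    angularInt_lt hd hφxhi (hM.integrable hp hsol.1.memLp) hlt,
    angularInt_le (hM.integrable hp h.emission_lo.memLp) (hM.integrable hp hsol.2.memLp)
      (hencl.mono fun _ hz => hz.2.2.1)] with x hη hμaxi hμ hμam hpos hx hm
  exact lt_update_energy hη.2 hμaxi hμ.le hμam.le hpos hx hm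

end Medium.IsStage

theorem IsCoeff.max_of_le (hμ : IsCoeff Ω c₁ c₂ μ) (hlo : IsCoeff Ω c₁ c₂ μlo)
    (hg : AEStronglyMeasurable g (volume.restrict Ω))
    (hν : ∀ᵐ x ∂(volume.restrict Ω), ν x = max (μlo x) (g x))
    (hνμ : ∀ᵐ x ∂(volume.restrict Ω), ν x ≤ μ x) : IsCoeff Ω c₁ c₂ ν where
  aestronglyMeasurable := (hlo.aestronglyMeasurable.sup hg).congr (hν.mono fun _ hx => hx.symm)
  bounds := by
    filter_upwards [hν, hνμ, hlo.bounds, hμ.bounds] with x hx hxμ hlox hμx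
    exact ⟨hlox.1.trans (hx ▸ le_max_left _ _), hxμ.trans hμx.2⟩

theorem IsCoeff.min_of_le (hμ : IsCoeff Ω c₁ c₂ μ) (hhi : IsCoeff Ω c₁ c₂ μhi)
    (hg : AEStronglyMeasurable g (volume.restrict Ω))
    (hν : ∀ᵐ x ∂(volume.restrict Ω), ν x = min (μhi x) (g x))
    (hμν : ∀ᵐ x ∂(volume.restrict Ω), μ x ≤ ν x) : IsCoeff Ω c₁ c₂ ν where
  aestronglyMeasurable := (hhi.aestronglyMeasurable.inf hg).congr (hν.mono fun _ hx => hx.symm)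
  bounds := by
    filter_upwards [hν, hμν, hhi.bounds, hμ.bounds] with x hx hxμ hhix hμx
    exact ⟨hμx.1.trans hxμ, (hx ▸ min_le_left _ _ : ν x ≤ μhi x).trans hhix.2⟩

theorem IsBracket.of_eq_const (hlt : ∀ᵐ x ∂(volume.restrict Ω), c₁ < μ x ∧ μ x < c₂)
    (hlo : ∀ᵐ x ∂(volume.restrict Ω), μlo x = c₁) (hhi : ∀ᵐ x ∂(volume.restrict Ω), μhi x = c₂) :
    IsBracket Ω c₁ c₂ μ μlo μhi where
  lo.aestronglyMeasurable := aestronglyMeasurable_const.congr (hlo.mono fun _ hx => hx.symm)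
  lo.bounds := by
    filter_upwards [hlt, hlo] with x hx hlox
    exact ⟨hlox.ge, hlox ▸ (hx.1.trans hx.2).le⟩
  hi.aestronglyMeasurable := aestronglyMeasurable_const.congr (hhi.mono fun _ hx => hx.symm)
  hi.bounds := by
    filter_upwards [hlt, hhi] with x hx hhix
    exact ⟨hhix ▸ (hx.1.trans hx.2).le, hhix.le⟩
  lo_le := by filter_upwards [hlt, hlo] with x hx hlox using hlox ▸ hx.1.le
  lt_hi := by filter_upwards [hlt, hhi] with x hx hhix using hhix ▸ hx.2

theorem IsBracket.succ (hM : M.Admissible p c₁ c₂) (hd : 0 < d) (hp : 1 ≤ p)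
    (hμ : IsCoeff M.Ω c₁ c₂ μ) (hsol : M.IsSolution p μ φx φm)
    (hbr : IsBracket M.Ω c₁ c₂ μ μlo μhi) (h : M.IsStage p μlo μhi φxlo φxhi φmlo φmhi)
    (hlo' : ∀ᵐ x ∂(volume.restrict M.Ω),
      μlo' x = max (μlo x) (M.update (M.energy μ φx φm) φxlo φmhi x))
    (hhi' : ∀ᵐ x ∂(volume.restrict M.Ω),
      μhi' x = min (μhi x) (M.update (M.energy μ φx φm) φxhi φmlo x)) :
    IsBracket M.Ω c₁ c₂ μ μlo' μhi' := by
  have hlo_le : ∀ᵐ x ∂(volume.restrict M.Ω), μlo' x ≤ μ x := by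
    filter_upwards [hlo', hbr.lo_le, h.update_lo_le hM hd hp hμ hsol hbr] with x hx hlox hupd
    exact hx ▸ max_le hlox hupd
  have hlt_hi : ∀ᵐ x ∂(volume.restrict M.Ω), μ x < μhi' x := by
    filter_upwards [hhi', hbr.lt_hi, h.lt_update_hi hM hd hp hμ hsol hbr] with x hx hhix hupd
    exact hx ▸ lt_min hhix hupd
  have hφx := hM.integrable hp hsol.1.memLp
  have hφm := hM.integrable hp hsol.2.memLp
  exact
    { lo := hμ.max_of_le hbr.lo (hM.aestronglyMeasurable_update hμ.aestronglyMeasurable hφx hφm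
        (hM.integrable hp h.excitation_lo.memLp) (hM.integrable hp h.emission_hi.memLp)) hlo' hlo_le
      hi := hμ.min_of_le hbr.hi (hM.aestronglyMeasurable_update hμ.aestronglyMeasurable hφx hφm
        (hM.integrable hp h.excitation_hi.memLp) (hM.integrable hp h.emission_lo.memLp)) hhi'
        (hlt_hi.mono fun _ hx => hx.le)
      lo_le := hlo_le
      lt_hi := hlt_hi }

theorem Medium.IsSIM.isBracket (hM : M.Admissible p c₁ c₂) (hd : 0 < d) (hp : 1 ≤ p)
    (hμ : IsCoeff M.Ω c₁ c₂ μ) (hlt : ∀ᵐ x ∂(volume.restrict M.Ω), c₁ < μ x ∧ μ x < c₂)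
    (hsol : M.IsSolution p μ φx φm) {s : Iterates d}
    (hs : M.IsSIM p c₁ c₂ (M.energy μ φx φm) s) (i : ℕ) :
    IsBracket M.Ω c₁ c₂ μ (s.μlo i) (s.μhi i) := by
  induction i with
  | zero => exact .of_eq_const hlt hs.lo_zero hs.hi_zero
  | succ i ih => exact ih.succ hM hd hp hμ hsol (hs.isStage i) (hs.lo_succ i) (hs.hi_succ i)

theorem Medium.Admissible.exists_isSIM (hM : M.Admissible p c₁ c₂) (hd : 0 < d) (hp : 1 ≤ p)
    (hμ : IsCoeff M.Ω c₁ c₂ μ) (hlt : ∀ᵐ x ∂(volume.restrict M.Ω), c₁ < μ x ∧ μ x < c₂)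
    (hsol : M.IsSolution p μ φx φm) : ∃ s, M.IsSIM p c₁ c₂ (M.energy μ φx φm) s := by
  let Bracket := {b : (Space d → ℝ) × (Space d → ℝ) // IsBracket M.Ω c₁ c₂ μ b.1 b.2}
  choose φxlo φxhi φmlo φmhi hstage using
    fun b : Bracket => hM.exists_isStage hd hp b.2.lo b.2.hi
  let initial : Bracket := ⟨(fun _ => c₁, fun _ => c₂),
    .of_eq_const hlt (ae_of_all _ fun _ => rfl) (ae_of_all _ fun _ => rfl)⟩
  let next (b : Bracket) : Bracket :=
    ⟨(fun x => max (b.1.1 x) (M.update (M.energy μ φx φm) (φxlo b) (φmhi b) x),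
      fun x => min (b.1.2 x) (M.update (M.energy μ φx φm) (φxhi b) (φmlo b) x)),
      b.2.succ hM hd hp hμ hsol (hstage b) (ae_of_all _ fun _ => rfl) (ae_of_all _ fun _ => rfl)⟩
  let b (i : ℕ) : Bracket := next^[i] initial
  have hb (i : ℕ) : b (i + 1) = next (b i) := Function.iterate_succ_apply' next i initial
  refine ⟨⟨fun i => (b i).1.1, fun i => (b i).1.2, fun i => φxlo (b i), fun i => φxhi (b i),
    fun i => φmlo (b i), fun i => φmhi (b i)⟩, ?_⟩
  exact
    { lo_zero := ae_of_all _ fun _ => rfl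
      hi_zero := ae_of_all _ fun _ => rfl
      excitation_lo := fun i => (hstage (b i)).excitation_lo
      excitation_hi := fun i => (hstage (b i)).excitation_hi
      emission_hi := fun i => (hstage (b i)).emission_hi
      emission_lo := fun i => (hstage (b i)).emission_lo
      lo_succ := fun i => ae_of_all _ fun x => by simp only [hb, next]
      hi_succ := fun i => ae_of_all _ fun x => by simp only [hb, next] }

end Squeeze

end FPAT

end

theorem theorem3_general {d : ℕ} (hd : 0 < d) (M : FPAT.Medium d) (p : ℝ≥0∞) (hp : 1 ≤ p)
    (c₁ c₂ : ℝ) (hM : M.Admissible p c₁ c₂) (μ : FPAT.Space d → ℝ)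
    (hμ : FPAT.IsCoeff M.Ω c₁ c₂ μ)
    (hlt : ∀ᵐ x ∂(volume.restrict M.Ω), c₁ < μ x ∧ μ x < c₂) :
    (∃ φx φm, M.IsSolution p μ φx φm) ∧
    ∀ φx φm, M.IsSolution p μ φx φm →
      (∃ s, M.IsSIM p c₁ c₂ (M.energy μ φx φm) s) ∧
      ∀ s, M.IsSIM p c₁ c₂ (M.energy μ φx φm) s →
        (∀ i, ∀ᵐ x ∂(volume.restrict M.Ω),
          s.μlo i x ≤ s.μlo (i + 1) x ∧ s.μlo i x ≤ μ x ∧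
          μ x < s.μhi i x ∧ s.μhi (i + 1) x ≤ s.μhi i x) ∧
        (∀ i, ∀ᵐ z ∂(FPAT.phaseMeasure M.Ω),
          s.φxlo (i + 1) z ≤ s.φxlo i z ∧ φx z ≤ s.φxlo i z ∧
          s.φxhi i z ≤ φx z ∧ s.φxhi i z ≤ s.φxhi (i + 1) z) ∧
        (∀ i, ∀ᵐ z ∂(FPAT.phaseMeasure M.Ω),
          s.φmlo i z ≤ s.φmlo (i + 1) z ∧ s.φmlo i z ≤ φm z ∧
          φm z ≤ s.φmhi i z ∧ s.φmhi (i + 1) z ≤ s.φmhi i z) ∧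
        ((∀ᵐ x ∂(volume.restrict M.Ω), 0 < M.η x) →
          ∀ i, ∀ᵐ z ∂(FPAT.phaseMeasure M.Ω), φm z < s.φmhi i z) := by
  refine ⟨hM.exists_isSolution hd hp hμ, fun φx φm hsol =>
    ⟨hM.exists_isSIM hd hp hμ hlt hsol, fun s hs => ?_⟩⟩
  have hbr := hs.isBracket hM hd hp hμ hlt hsol
  have hmono (i : ℕ) := (hs.isStage i).mono hM hd hp (hbr i).lo (hbr i).hi (hbr (i + 1)).lo
    (hbr (i + 1)).hi (hs.isStage (i + 1)) (hs.lo_le_succ i) (hs.hi_succ_le i)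
  have hencl (i : ℕ) := (hs.isStage i).encloses hM hd hp hμ hsol (hbr i)
  refine ⟨fun i => ?_, fun i => ?_, fun i => ?_, fun hη i =>
    (hs.isStage i).emission_lt_hi hM hd hp hμ hsol (hbr i) hη⟩
  · filter_upwards [hs.lo_le_succ i, (hbr i).lo_le, (hbr i).lt_hi, hs.hi_succ_le i]
      with x hlo hle hgt hhi using ⟨hlo, hle, hgt, hhi⟩
  · filter_upwards [hmono i, hencl i] with z ⟨hlo, hhi, _⟩ ⟨hle, hge, _⟩
      using ⟨hlo, hle, hge, hhi⟩
  · filter_upwards [hmono i, hencl i] with z ⟨_, _, hlo, hhi⟩ ⟨_, _, hle, hge⟩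
      using ⟨hlo, hle, hge, hhi⟩

theorem theorem3 {d : ℕ} (hd : d = 2 ∨ d = 3) (M : FPAT.Medium d) (p : ℝ≥0∞) (hp : 1 ≤ p)
    (c₁ c₂ : ℝ) (hM : M.Admissible p c₁ c₂) (μ : FPAT.Space d → ℝ)
    (hμ : FPAT.IsCoeff M.Ω c₁ c₂ μ)
    (hlt : ∀ᵐ x ∂(volume.restrict M.Ω), c₁ < μ x ∧ μ x < c₂) :
    (∃ φx φm, M.IsSolution p μ φx φm) ∧
    ∀ φx φm, M.IsSolution p μ φx φm →
      (∃ s, M.IsSIM p c₁ c₂ (M.energy μ φx φm) s) ∧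
      ∀ s, M.IsSIM p c₁ c₂ (M.energy μ φx φm) s →
        (∀ i, ∀ᵐ x ∂(volume.restrict M.Ω),
          s.μlo i x ≤ s.μlo (i + 1) x ∧ s.μlo i x ≤ μ x ∧
          μ x < s.μhi i x ∧ s.μhi (i + 1) x ≤ s.μhi i x) ∧
        (∀ i, ∀ᵐ z ∂(FPAT.phaseMeasure M.Ω),
          s.φxlo (i + 1) z ≤ s.φxlo i z ∧ φx z ≤ s.φxlo i z ∧
          s.φxhi i z ≤ φx z ∧ s.φxhi i z ≤ s.φxhi (i + 1) z) ∧
        (∀ i, ∀ᵐ z ∂(FPAT.phaseMeasure M.Ω),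
          s.φmlo i z ≤ s.φmlo (i + 1) z ∧ s.φmlo i z ≤ φm z ∧
          φm z ≤ s.φmhi i z ∧ s.φmhi (i + 1) z ≤ s.φmhi i z) ∧
        ((∀ᵐ x ∂(volume.restrict M.Ω), 0 < M.η x) →
          ∀ i, ∀ᵐ z ∂(FPAT.phaseMeasure M.Ω), φm z < s.φmhi i z) :=
  theorem3_general (by omega) M p hp c₁ c₂ hM μ hμ hlt
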